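/- **Setting.** Let $\mathcal X=\{1,2,3,\dots\}$ and let $\mathcal P(\mathcal X)$ be the set of probability distributions on $\mathcal X$. For $P\in\mathcal P(\mathcal X)$ let $P^{\downarrow}$ be its decreasing rearrangement ($P^{\downarrow}(k)$ is the $k$-th largest mass of $P$, counted with multiplicity). Let $\phi:\mathcal P(\mathcal X)\to[0,\infty]$ be symmetric ($\phi(P)=\phi(P^{\downarrow})$ for all $P$), concave, and lower semicontinuous with respect to pointwise convergence. For random variables $X\in\mathcal X$ and $Y\in\mathcal Y$ on a common probability space put $\mathfrak h_\phi(X\mid Y)=\mathbb E[\phi(P_{X|Y})]$, where $P_{X|Y}$ is the conditional distribution of $X$ given $Y$, and $$P_{\mathrm e}^{(L)}(X\mid Y)=\min_f\mathbb P\{X\notin f(Y)\},$$ the minimum being over all maps $f$ from $\mathcal Y$ to the nonempty subsets of $\mathcal X$ with at most $L$ elements. For $Q\in\mathcal P(\mathcal X)$ put $P_{\mathrm e}^{(L)}(Q)=1-\sum_{x=1}^{L}Q^{\downarrow}(x)$. Let $\mathcal Y$ be a finite set with its discrete $\sigma$-algebra, $L\ge1$ an integer, $Q\in\mathcal P(\mathcal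 X)$, and let $\varepsilon$ satisfy $$1-\sum_{x=1}^{|\mathcal Y|L}Q^{\downarrow}(x)\le\varepsilon\le P_{\mathrm e}^{(L)}(Q).$$ Define $V(j)=\frac{(1-\varepsilon)-\sum_{x=1}^{j-1}Q^{\downarrow}(x)}{L-j+1}$ for $1\le j\le L$ and $V(j)=1$ for $j>L$; $W(L)=-1$, $W(k)=\frac{\sum_{x=1}^{k}Q^{\downarrow}(x)-(1-\varepsilon)}{k-L}$ for $L<k<\infty$, and $W(\infty)=0$; $$J=\min\{j\ge1: Q^{\downarrow}(j)<V(j)\},\qquad K_1=\sup\{L\le k<\infty: W(k)<Q^{\downarrow}(k)\},$$ $$K_2=\max\{L\le k\le|\mathcal Y|L: W(k)<Q^{\downarrow}(k)\}.$$ For $i=1,2$ let $P_i$ (the Fano distribution of type $i$) be the distribution on $\mathcal X$ with $P_i(x)=Q^{\downarrow}(x)$ if $x<J$ or $x>K_i$, $P_i(x)=V(J)$ if $J\le x\le L$, and $P_i(x)=W(K_i)$ if $L<x\le K_i$. **Theorem.** Let $$S=\sup\{\mathfrak h_\phi(X\mid Y): P_{\mathrm e}^{(L)}(X\mid Y)\le\varepsilon,\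 P_X=Q\},$$ the supremum being over all $\mathcal X\times\mathcal Y$-valued random variables $(X,Y)$. Then: 1. $S\le\phi(P_2)\le\phi(P_1)$. 2. $S=\phi(P_2)$ if $\varepsilon=P_{\mathrm e}^{(L)}(Q)$, or if $|\mathcal Y|\ge\min\left\{\binom{K_2-J+1}{L-J+1},(K_2-J)^2+1\right\}$. 3. If $P_X=Q$ and $$P_{X|Y}^{\downarrow}(x)=P_2^{\downarrow}(x)\quad\text{almost surely, for every }x\in\mathcal X,\tag{$*$}$$ then $P_{\mathrm e}^{(L)}(X\mid Y)\le\varepsilon$ and $\mathfrak h_\phi(X\mid Y)=S=\phi(P_2)$. 4. Suppose that the concavity of $\phi$ is strict (i.e. $\lambda\phi(P)+(1-\lambda)\phi(R)<\phi(\lambda P+(1-\lambda)R)$ whenever $P\ne R$, $0<\lambda<1$ and $\phi(P),\phi(R)<\infty$), that $\phi(P_2)<\infty$, and that $S=\phi(P_2)$. Then a pair $(X,Y)$ with $P_X=Q$ satisfies $P_{\mathrm e}^{(L)}(X\mid Y)\le\varepsilon$ and $\mathfrak h_\phi(X\mid Y)=S$ if and only if $(*)$ holds. -/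

import Mathlib

open MeasureTheory ProbabilityTheory Filter Topology
open scoped ENNReal

/-- A probability distribution on the countably infinite alphabet `{1, 2, 3, …}`. The symbol
written `x` on paper is represented by the natural number `x - 1`, so `P.mass i = P(i + 1)`. -/
@[ext]
structure Marginal where
  mass : ℕ → ℝ
  nonneg : ∀ x, 0 ≤ mass x
  hasSum : HasSum mass 1

namespace Marginal

theorem mass_le_one (P : Marginal) (x : ℕ) : P.mass x ≤ 1 :=
  le_hasSum P.hasSum x fun y _ => P.nonneg y

/-- The `(i + 1)`-st largest mass of `P` (counted with multiplicity), i.e. `P↓(i + 1)`: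
the largest `t` such that at least `i + 1` symbols have mass at least `t`. -/
noncomputable def decMass (P : Marginal) (i : ℕ) : ℝ :=
  sSup {t : ℝ | ((i + 1 : ℕ) : ℕ∞) ≤ {x | t ≤ P.mass x}.encard}

theorem bddAbove_decMass (P : Marginal) (i : ℕ) :
    BddAbove {t : ℝ | ((i + 1 : ℕ) : ℕ∞) ≤ {x | t ≤ P.mass x}.encard} := by
  refine ⟨1, fun t ht => ?_⟩
  have hne : {x | t ≤ P.mass x}.Nonempty := by
    rw [← Set.encard_pos]
    exact lt_of_lt_of_le (by exact_mod_cast Nat.succ_pos i) ht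
  obtain ⟨x, hx⟩ := hne
  exact le_trans hx (P.mass_le_one x)

theorem zero_mem_decMass (P : Marginal) (i : ℕ) :
    (0 : ℝ) ∈ {t : ℝ | ((i + 1 : ℕ) : ℕ∞) ≤ {x | t ≤ P.mass x}.encard} := by
  have : {x | 0 ≤ P.mass x} = Set.univ := Set.eq_univ_of_forall P.nonneg
  simp [this]

theorem decMass_nonneg (P : Marginal) (i : ℕ) : 0 ≤ P.decMass i :=
  le_csSup (P.bddAbove_decMass i) (P.zero_mem_decMass i)

theorem decMass_antitone (P : Marginal) : Antitone P.decMass := by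
  intro i j hij
  refine csSup_le_csSup (P.bddAbove_decMass i) ⟨0, P.zero_mem_decMass j⟩ fun t ht => ?_
  have h : ((i + 1 : ℕ) : ℕ∞) ≤ ((j + 1 : ℕ) : ℕ∞) := Nat.cast_le.2 (Nat.succ_le_succ hij)
  exact h.trans ht

theorem lt_decMass_iff (P : Marginal) (t : ℝ) (i : ℕ) :
    t < P.decMass i ↔ ((i + 1 : ℕ) : ℕ∞) ≤ {x | t < P.mass x}.encard := by
  constructor
  · intro h
    obtain ⟨s, hs, hts⟩ := exists_lt_of_lt_csSup ⟨0, P.zero_mem_decMass i⟩ h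
    exact le_trans hs (Set.encard_le_encard fun x hx => lt_of_lt_of_le hts hx)
  · intro h
    obtain ⟨s, hsub, hcard⟩ := Set.exists_subset_encard_eq h
    have hfin : s.Finite := Set.finite_of_encard_eq_coe hcard
    have hne : s.Nonempty := by
      rw [← Set.encard_pos, hcard]
      exact_mod_cast Nat.succ_pos i
    obtain ⟨x, hx, hmin⟩ := hfin.exists_minimalFor P.mass s hne
    have hmin' : ∀ y ∈ s, P.mass x ≤ P.mass y := fun y hy =>
      (le_total (P.mass x) (P.mass y)).elim id fun h' => hmin hy h'
    refine lt_of_lt_of_le (hsub hx) (le_csSup (P.bddAbove_decMass i) ?_)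
    change ((i + 1 : ℕ) : ℕ∞) ≤ _
    rw [← hcard]
    exact Set.encard_le_encard hmin'

theorem encard_setOf_succ_le (n : ℕ∞) : {i : ℕ | ((i + 1 : ℕ) : ℕ∞) ≤ n}.encard = n := by
  induction n using ENat.recTopCoe with
  | top => simp
  | coe n =>
    have : {i : ℕ | ((i + 1 : ℕ) : ℕ∞) ≤ (n : ℕ∞)} = ↑(Finset.range n) := by
      ext i
      simp only [Set.mem_ofPred_eq, Finset.coe_range, Set.mem_Iio]
      rw [Nat.cast_le]
      omega
    rw [this, Set.encard_coe_eq_coe_finsetCard, Finset.card_range]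

theorem hasSum_decMass (P : Marginal) : HasSum P.decMass 1 := by
  have h1 : ∫⁻ x, ENNReal.ofReal (P.mass x) ∂Measure.count
      = ∫⁻ x, ENNReal.ofReal (P.decMass x) ∂Measure.count := by
    rw [lintegral_eq_lintegral_meas_lt _ (ae_of_all _ P.nonneg) (by fun_prop),
      lintegral_eq_lintegral_meas_lt _ (ae_of_all _ P.decMass_nonneg) (by fun_prop)]
    refine lintegral_congr fun t => ?_
    rw [Measure.count_apply (MeasurableSet.of_discrete),
      Measure.count_apply (MeasurableSet.of_discrete)]
    simp_rw [lt_decMass_iff, encard_setOf_succ_le]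
  rw [lintegral_count, lintegral_count,
    ← ENNReal.ofReal_tsum_of_nonneg P.nonneg P.hasSum.summable, P.hasSum.tsum_eq,
    ENNReal.ofReal_one] at h1
  have h2 : Summable P.decMass := by
    have := ENNReal.summable_toReal (f := fun x => ENNReal.ofReal (P.decMass x))
      (by rw [← h1]; exact ENNReal.one_ne_top)
    simpa only [ENNReal.toReal_ofReal (P.decMass_nonneg _)] using this
  rw [← ENNReal.ofReal_tsum_of_nonneg P.decMass_nonneg h2] at h1
  have h3 : ∑' x, P.decMass x = 1 := by
    have := congrArg ENNReal.toReal h1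
    rwa [ENNReal.toReal_ofReal (tsum_nonneg P.decMass_nonneg), ENNReal.toReal_one, eq_comm]
      at this
  rw [← h3]
  exact h2.hasSum

/-- The decreasing rearrangement `P↓` of `P`. -/
noncomputable def dec (P : Marginal) : Marginal where
  mass := P.decMass
  nonneg := P.decMass_nonneg
  hasSum := P.hasSum_decMass

/-- The mixture `l P + (1 - l) R`. -/
noncomputable def mix (l : ℝ) (hl : l ∈ Set.Icc (0 : ℝ) 1) (P R : Marginal) : Marginal where
  mass x := l * P.mass x + (1 - l) * R.mass x
  nonneg x := add_nonneg (mul_nonneg hl.1 (P.nonneg x))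
    (mul_nonneg (sub_nonneg.2 hl.2) (R.nonneg x))
  hasSum := by simpa using (P.hasSum.mul_left l).add (R.hasSum.mul_left (1 - l))

/-- The marginal with masses `ν {x}`. -/
noncomputable def ofMeasure (ν : Measure ℕ) [IsProbabilityMeasure ν] : Marginal where
  mass x := ν.real {x}
  nonneg _ := measureReal_nonneg
  hasSum := by
    have h : ∑' x : ℕ, ν {x} = 1 := by
      have := Measure.tsum_indicator_apply_singleton ν Set.univ MeasurableSet.univ
      simpa using this
    have h2 := ENNReal.hasSum_toReal (f := fun x : ℕ => ν {x}) (by rw [h]; simp)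
    rwa [← ENNReal.tsum_toReal_eq (fun x => measure_ne_top ν _), h, ENNReal.toReal_one] at h2

/-- `∑_{x = 1}^{k} P↓(x)`. -/
noncomputable def topSum (P : Marginal) (k : ℕ) : ℝ := ∑ i ∈ Finset.range k, P.decMass i

/-- The minimum error probability of list decoding with list size `L` without side information,
`1 - ∑_{x = 1}^{L} Q↓(x)`. -/
noncomputable def listError (Q : Marginal) (L : ℕ) : ℝ := 1 - Q.topSum L

theorem topSum_succ (P : Marginal) (k : ℕ) : P.topSum (k + 1) = P.topSum k + P.decMass k :=
  Finset.sum_range_succ _ _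

theorem topSum_le_one (P : Marginal) (k : ℕ) : P.topSum k ≤ 1 :=
  sum_le_hasSum _ (fun i _ => P.decMass_nonneg i) P.hasSum_decMass

end Marginal

/-! ### Postulates on the information measure -/

/-- Invariance under rearrangement: `φ(P) = φ(P↓)`. -/
def IsSymmetric (φ : Marginal → ℝ≥0∞) : Prop := ∀ P, φ P = φ P.dec

/-- Lower semicontinuity along pointwise convergent sequences of marginals. -/
def IsLowerSemicont (φ : Marginal → ℝ≥0∞) : Prop :=
  ∀ (P : Marginal) (p : ℕ → Marginal),
    (∀ x, Tendsto (fun n => (p n).mass x) atTop (𝓝 (P.mass x))) →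
      φ P ≤ liminf (fun n => φ (p n)) atTop

def IsConcave (φ : Marginal → ℝ≥0∞) : Prop :=
  ∀ (P R : Marginal) (l : ℝ) (hl : l ∈ Set.Icc (0 : ℝ) 1),
    ENNReal.ofReal l * φ P + ENNReal.ofReal (1 - l) * φ R ≤ φ (Marginal.mix l hl P R)

/-- Strictness of the concavity inequality at distinct points with finite values; at a point of
infinite value a strict inequality is impossible. -/
def IsStrictConcave (φ : Marginal → ℝ≥0∞) : Prop :=
  ∀ (P R : Marginal) (l : ℝ) (hl : l ∈ Set.Ioo (0 : ℝ) 1), P ≠ R → φ P ≠ ∞ → φ R ≠ ∞ →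
    ENNReal.ofReal l * φ P + ENNReal.ofReal (1 - l) * φ R
      < φ (Marginal.mix l (Set.Ioo_subset_Icc_self hl) P R)

/-! ### Fano distributions -/

section Fano

variable (Q : Marginal) (L : ℕ) (ε : ℝ)

/-- The weight `V(j)`, `j ≥ 1`. -/
noncomputable def fanoV (j : ℕ) : ℝ :=
  if j ≤ L then ((1 - ε) - Q.topSum (j - 1)) / ((L : ℝ) - j + 1) else 1

/-- The weight `W(k)`, `L ≤ k ≤ ∞`. -/
noncomputable def fanoW (k : ℕ∞) : ℝ :=
  if k = ⊤ then 0
  else if k = L then -1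
  else (Q.topSum k.toNat - (1 - ε)) / ((k.toNat : ℝ) - L)

/-- `J = min {j ≥ 1 | Q↓(j) < V(j)}`. -/
noncomputable def fanoJ : ℕ := sInf {j : ℕ | 1 ≤ j ∧ Q.decMass (j - 1) < fanoV Q L ε j}

/-- `K₁ = sup {L ≤ k < ∞ | W(k) < Q↓(k)}`, possibly infinite. -/
noncomputable def fanoK₁ : ℕ∞ :=
  sSup {k : ℕ∞ | ∃ n : ℕ, k = n ∧ L ≤ n ∧ fanoW Q L ε n < Q.decMass (n - 1)}

/-- `K₂ = max {L ≤ k ≤ N L | W(k) < Q↓(k)}`, where `N` is the size of the side-information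
alphabet. -/
noncomputable def fanoK₂ (N : ℕ) : ℕ :=
  sSup {k : ℕ | L ≤ k ∧ k ≤ N * L ∧ fanoW Q L ε k < Q.decMass (k - 1)}

/-- The masses of the Fano distributions, for a given upper cut-off `K`: at the symbol `x + 1`
the value is `Q↓(x + 1)` if `x + 1 < J` or `K < x + 1`, it is `V(J)` if `J ≤ x + 1 ≤ L`, and it
is `W(K)` if `L < x + 1 ≤ K`. -/
noncomputable def fanoMass (K : ℕ∞) (x : ℕ) : ℝ :=
  if x + 1 < fanoJ Q L ε ∨ K < ((x + 1 : ℕ) : ℕ∞) then Q.decMass x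
  else if x + 1 ≤ L then fanoV Q L ε (fanoJ Q L ε)
  else fanoW Q L ε K

theorem fanoJ_spec (hL : 1 ≤ L) :
    1 ≤ fanoJ Q L ε ∧ fanoJ Q L ε ≤ L + 1 ∧
      Q.decMass (fanoJ Q L ε - 1) < fanoV Q L ε (fanoJ Q L ε) := by
  have hmem : L + 1 ∈ {j : ℕ | 1 ≤ j ∧ Q.decMass (j - 1) < fanoV Q L ε j} := by
    refine ⟨by omega, ?_⟩
    have h2 := Q.topSum_le_one 2
    have h3 : Q.topSum 2 = Q.decMass 0 + Q.decMass 1 := by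
      simp [Marginal.topSum, Finset.sum_range_succ]
    have h4 := Q.decMass_antitone (Nat.zero_le 1)
    have h5 := Q.decMass_antitone hL
    have h6 : fanoV Q L ε (L + 1) = 1 := by simp [fanoV]
    rw [h6, Nat.add_sub_cancel]
    linarith
  have h := Nat.sInf_mem ⟨_, hmem⟩
  exact ⟨h.1, Nat.sInf_le hmem, h.2⟩

theorem fanoV_nonneg (hL : 1 ≤ L) : 0 ≤ fanoV Q L ε (fanoJ Q L ε) :=
  (Q.decMass_nonneg _).trans (fanoJ_spec Q L ε hL).2.2.le

theorem sum_fanoMass_low (hL : 1 ≤ L) (hε : ε ≤ Q.listError L) (K : ℕ∞) (hK : (L : ℕ∞) ≤ K) :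
    ∑ i ∈ Finset.range L, fanoMass Q L ε K i = 1 - ε := by
  obtain ⟨h1, h2, h3⟩ := fanoJ_spec Q L ε hL
  set J := fanoJ Q L ε with hJ
  have hsplit : ∑ i ∈ Finset.range L, fanoMass Q L ε K i
      = Q.topSum (J - 1) + ((L - (J - 1) : ℕ) : ℝ) * fanoV Q L ε J := by
    rw [← Finset.sum_range_add_sum_Ico _ (by omega : J - 1 ≤ L), Marginal.topSum]
    congr 1
    · refine Finset.sum_congr rfl fun i hi => ?_
      rw [Finset.mem_range] at hi
      rw [fanoMass, if_pos (Or.inl (by omega))]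
    · rw [← Nat.card_Ico (J - 1) L, ← nsmul_eq_mul, ← Finset.sum_const]
      refine Finset.sum_congr rfl fun i hi => ?_
      rw [Finset.mem_Ico] at hi
      have hK' : ((i + 1 : ℕ) : ℕ∞) ≤ K := (Nat.cast_le.2 (by omega)).trans hK
      rw [fanoMass, if_neg (by rw [not_or]; exact ⟨by omega, not_lt.2 hK'⟩), if_pos (by omega)]
  rw [hsplit]
  rcases Nat.lt_or_ge L J with hlt | hle
  · have hJL : J = L + 1 := by omega
    have hnot : ¬ (1 ≤ L ∧ Q.decMass (L - 1) < fanoV Q L ε L) := fun hmem =>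
      absurd (show J ≤ L from Nat.sInf_le hmem) (by omega)
    have hV : fanoV Q L ε L ≤ Q.decMass (L - 1) := by
      by_contra hc
      exact hnot ⟨hL, not_le.1 hc⟩
    rw [fanoV, if_pos le_rfl, sub_self, zero_add, div_one] at hV
    have hs := Q.topSum_succ (L - 1)
    rw [Nat.sub_add_cancel hL] at hs
    rw [Marginal.listError] at hε
    rw [hJL, Nat.add_sub_cancel, Nat.sub_self, Nat.cast_zero, zero_mul]
    linarith
  · rw [fanoV, if_pos hle]
    have hc : ((L - (J - 1) : ℕ) : ℝ) = (L : ℝ) - J + 1 := by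
      rw [Nat.cast_sub (by omega), Nat.cast_sub h1]
      push_cast
      ring
    have hpos : (0 : ℝ) < (L : ℝ) - J + 1 := by
      have : (J : ℝ) ≤ L := by exact_mod_cast hle
      linarith
    rw [hc, mul_div_cancel₀ _ hpos.ne']
    ring

theorem fanoW_nat {n : ℕ} (hn : L < n) :
    fanoW Q L ε n = (Q.topSum n - (1 - ε)) / ((n : ℝ) - L) := by
  have h : ¬ ((n : ℕ∞) = L) := by
    rw [Nat.cast_inj]
    omega
  rw [fanoW, if_neg (ENat.natCast_ne_top n), if_neg h, ENat.toNat_natCast]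

/-- The Fano masses with a finite cut-off form a distribution. -/
theorem fanoMass_nat (hL : 1 ≤ L) (hε : ε ≤ Q.listError L) (n : ℕ) (hn : L ≤ n)
    (hS : 1 - ε ≤ Q.topSum n) :
    (∀ x, 0 ≤ fanoMass Q L ε n x) ∧ HasSum (fanoMass Q L ε n) 1 := by
  constructor
  · intro x
    rw [fanoMass]
    split_ifs with h1 h2
    · exact Q.decMass_nonneg x
    · exact fanoV_nonneg Q L ε hL
    · have h1' : ((x + 1 : ℕ) : ℕ∞) ≤ n := not_lt.1 (not_or.1 h1).2
      rw [Nat.cast_le] at h1'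
      have hlt : L < n := by omega
      rw [fanoW_nat Q L ε hlt]
      have : (L : ℝ) < n := by exact_mod_cast hlt
      exact div_nonneg (by linarith) (by linarith)
  · have hlow := sum_fanoMass_low Q L ε hL hε n (Nat.cast_le.2 hn)
    obtain ⟨h1, h2, h3⟩ := fanoJ_spec Q L ε hL
    have hsum : ∑ i ∈ Finset.range n, fanoMass Q L ε n i = Q.topSum n := by
      rw [← Finset.sum_range_add_sum_Ico _ hn, hlow]
      rcases hn.eq_or_lt with rfl | hlt
      · rw [Marginal.listError] at hε
        rw [Finset.Ico_self, Finset.sum_empty]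
        linarith
      · have : ∑ i ∈ Finset.Ico L n, fanoMass Q L ε n i
            = ∑ i ∈ Finset.Ico L n, fanoW Q L ε n := by
          refine Finset.sum_congr rfl fun i hi => ?_
          rw [Finset.mem_Ico] at hi
          have hK' : ((i + 1 : ℕ) : ℕ∞) ≤ n := Nat.cast_le.2 (by omega)
          rw [fanoMass, if_neg (by rw [not_or]; exact ⟨by omega, not_lt.2 hK'⟩),
            if_neg (by omega)]
        have hpos : (L : ℝ) < n := by exact_mod_cast hlt
        rw [this, Finset.sum_const, nsmul_eq_mul, Nat.card_Ico, Nat.cast_sub hn,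
          fanoW_nat Q L ε hlt, mul_div_cancel₀ _ (by linarith)]
        ring
    have hdiff : HasSum (fun i => fanoMass Q L ε n i - Q.decMass i)
        (∑ i ∈ Finset.range n, (fanoMass Q L ε n i - Q.decMass i)) := by
      refine hasSum_sum_of_ne_finset_zero fun i hi => ?_
      rw [Finset.mem_range, not_lt] at hi
      have : (n : ℕ∞) < ((i + 1 : ℕ) : ℕ∞) := Nat.cast_lt.2 (by omega)
      rw [fanoMass, if_pos (Or.inr this), sub_self]
    rw [Finset.sum_sub_distrib, hsum, ← Marginal.topSum, sub_self] at hdiff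
    simpa using hdiff.add Q.hasSum_decMass

/-- If `k + 1` fails the defining inequality of the cut-off, then `1 - ε ≤ ∑_{x ≤ k} Q↓(x)`. -/
theorem le_topSum_of_not_lt {k : ℕ} (hk : L ≤ k)
    (h : ¬ fanoW Q L ε ((k + 1 : ℕ) : ℕ∞) < Q.decMass k) : 1 - ε ≤ Q.topSum k := by
  rw [not_lt, fanoW_nat Q L ε (by omega)] at h
  have hk' : (L : ℝ) ≤ k := by exact_mod_cast hk
  rw [le_div_iff₀ (by push_cast; linarith), Q.topSum_succ] at h
  push_cast at h
  nlinarith [Q.decMass_nonneg k]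

theorem fanoW_self_lt : fanoW Q L ε L < Q.decMass (L - 1) := by
  have : fanoW Q L ε L = -1 := by simp [fanoW]
  rw [this]
  linarith [Q.decMass_nonneg (L - 1)]

theorem fanoK₂_spec (hL : 1 ≤ L) (hε : ε ≤ Q.listError L) (N : ℕ)
    (hN : 1 - Q.topSum (N * L) ≤ ε) :
    L ≤ fanoK₂ Q L ε N ∧ 1 - ε ≤ Q.topSum (fanoK₂ Q L ε N) := by
  have hN1 : 1 ≤ N := by
    by_contra hc
    have hN0 : N = 0 := by omega
    subst hN0
    rw [Nat.zero_mul] at hN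
    have h0 : Q.topSum 0 = 0 := by simp [Marginal.topSum]
    rw [Marginal.listError] at hε
    have hz : Q.topSum L ≤ 0 := by linarith
    have hd0 : Q.decMass 0 ≤ 0 := le_trans (Finset.single_le_sum
      (fun i _ => Q.decMass_nonneg i) (Finset.mem_range.2 hL)) hz
    have hall : ∀ i, Q.decMass i = 0 := fun i =>
      le_antisymm ((Q.decMass_antitone (Nat.zero_le i)).trans hd0) (Q.decMass_nonneg i)
    have := Q.hasSum_decMass
    rw [funext hall] at this
    exact zero_ne_one (hasSum_zero.unique this)
  set A := {k : ℕ | L ≤ k ∧ k ≤ N * L ∧ fanoW Q L ε k < Q.decMass (k - 1)} with hA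
  have hbdd : BddAbove A := ⟨N * L, fun k hk => hk.2.1⟩
  have hLA : L ∈ A := ⟨le_rfl, Nat.le_mul_of_pos_left L hN1, fanoW_self_lt Q L ε⟩
  have hmem : fanoK₂ Q L ε N ∈ A := Nat.sSup_mem ⟨L, hLA⟩ hbdd
  refine ⟨hmem.1, ?_⟩
  rcases hmem.2.1.eq_or_lt with heq | hlt
  · rw [heq]
    linarith
  · refine le_topSum_of_not_lt Q L ε hmem.1 fun hc => ?_
    have : fanoK₂ Q L ε N + 1 ∈ A := ⟨by have := hmem.1; omega, hlt, hc⟩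
    have := le_csSup hbdd this
    change _ ≤ fanoK₂ Q L ε N at this
    omega

theorem le_fanoK₁ : (L : ℕ∞) ≤ fanoK₁ Q L ε :=
  le_sSup ⟨L, rfl, le_rfl, fanoW_self_lt Q L ε⟩

/-- The cut-off `K₁` is infinite only if `ε = 0`. -/
theorem eps_nonpos_of_fanoK₁_top (h : fanoK₁ Q L ε = ⊤) : ε ≤ 0 := by
  by_contra hpos
  rw [not_le] at hpos
  have hlim : Tendsto Q.topSum atTop (𝓝 1) := Q.hasSum_decMass.tendsto_sum_nat
  have hlim0 : Tendsto Q.decMass atTop (𝓝 0) := Q.hasSum_decMass.summable.tendsto_atTop_zero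
  obtain ⟨m, hm⟩ := (hlim.eventually (lt_mem_nhds (by linarith : 1 - ε / 2 < 1))).exists
  have hlim1 : Tendsto (fun k => (m : ℝ) * Q.decMass k) atTop (𝓝 0) := by
    simpa using hlim0.const_mul (m : ℝ)
  obtain ⟨m', hm'⟩ := eventually_atTop.1
    (hlim1.eventually (gt_mem_nhds (by linarith : 0 < ε / 2)))
  have hbig : ((m + m' + L + 1 : ℕ) : ℕ∞) < fanoK₁ Q L ε := by
    rw [h]
    exact ENat.natCast_lt_top _
  obtain ⟨_, ⟨n, rfl, hLn, hn⟩, hlt⟩ := lt_sSup_iff.1 hbig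
  rw [Nat.cast_lt] at hlt
  have hnL : (L : ℝ) < n := by exact_mod_cast (by omega : L < n)
  rw [fanoW_nat Q L ε (by omega), div_lt_iff₀ (by linarith)] at hn
  have h1 : ((n : ℝ) - m) * Q.decMass (n - 1) ≤ Q.topSum n - Q.topSum m := by
    have hmn : m ≤ n := by omega
    rw [Marginal.topSum, Marginal.topSum, ← Finset.sum_Ico_eq_sub _ hmn, ← Nat.cast_sub hmn,
      ← Nat.card_Ico, ← nsmul_eq_mul]
    refine Finset.card_nsmul_le_sum _ _ _ fun i hi => Q.decMass_antitone ?_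
    rw [Finset.mem_Ico] at hi
    omega
  have h2 := hm' (n - 1) (by omega)
  have h3 : 0 ≤ (L : ℝ) * Q.decMass (n - 1) := mul_nonneg (Nat.cast_nonneg _) (Q.decMass_nonneg _)
  nlinarith

theorem fanoMass_top (hL : 1 ≤ L) (hε0 : ε = 0) (hε : ε ≤ Q.listError L) :
    (∀ x, 0 ≤ fanoMass Q L ε ⊤ x) ∧ HasSum (fanoMass Q L ε ⊤) 1 := by
  constructor
  · intro x
    rw [fanoMass]
    split_ifs
    · exact Q.decMass_nonneg x
    · exact fanoV_nonneg Q L ε hL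
    · simp [fanoW]
  · have hlow := sum_fanoMass_low Q L ε hL hε ⊤ le_top
    rw [hε0, sub_zero, ← hε0] at hlow
    rw [← hlow]
    refine hasSum_sum_of_ne_finset_zero fun i hi => ?_
    rw [Finset.mem_range, not_lt] at hi
    have := (fanoJ_spec Q L ε hL).2.1
    rw [fanoMass, if_neg (by rw [not_or]; exact ⟨by omega, not_top_lt⟩), if_neg (by omega)]
    simp [fanoW]

theorem fanoMass_K₁ (hL : 1 ≤ L) (hε0 : 0 ≤ ε) (hε : ε ≤ Q.listError L) :
    (∀ x, 0 ≤ fanoMass Q L ε (fanoK₁ Q L ε) x) ∧ HasSum (fanoMass Q L ε (fanoK₁ Q L ε)) 1 := by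
  rcases eq_or_ne (fanoK₁ Q L ε) ⊤ with h | h
  · rw [h]
    exact fanoMass_top Q L ε hL (le_antisymm (eps_nonpos_of_fanoK₁_top Q L ε h) hε0) hε
  · obtain ⟨n, hn⟩ := ENat.ne_top_iff_exists.1 h
    have hLn := le_fanoK₁ Q L ε
    rw [← hn] at hLn ⊢
    rw [Nat.cast_le] at hLn
    refine fanoMass_nat Q L ε hL hε n hLn (le_topSum_of_not_lt Q L ε hLn fun hc => ?_)
    have : ((n + 1 : ℕ) : ℕ∞) ≤ fanoK₁ Q L ε := le_sSup ⟨n + 1, rfl, by omega, hc⟩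
    rw [← hn, Nat.cast_le] at this
    omega

/-- The type-1 Fano distribution of a system `(Q, L, ε)` with `0 ≤ ε ≤ 1 - ∑_{x ≤ L} Q↓(x)`. -/
noncomputable def fanoType1 (hL : 1 ≤ L) (hε0 : 0 ≤ ε) (hε : ε ≤ Q.listError L) : Marginal where
  mass := fanoMass Q L ε (fanoK₁ Q L ε)
  nonneg := (fanoMass_K₁ Q L ε hL hε0 hε).1
  hasSum := (fanoMass_K₁ Q L ε hL hε0 hε).2

/-- The type-2 Fano distribution of a system `(Q, L, ε)` and a side-information alphabet with
`N` elements, where `1 - ∑_{x ≤ N L} Q↓(x) ≤ ε ≤ 1 - ∑_{x ≤ L} Q↓(x)`. -/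
noncomputable def fanoType2 (N : ℕ) (hL : 1 ≤ L) (hN : 1 - Q.topSum (N * L) ≤ ε)
    (hε : ε ≤ Q.listError L) : Marginal where
  mass := fanoMass Q L ε (fanoK₂ Q L ε N)
  nonneg := (fanoMass_nat Q L ε hL hε _ (fanoK₂_spec Q L ε hL hε N hN).1
    (fanoK₂_spec Q L ε hL hε N hN).2).1
  hasSum := (fanoMass_nat Q L ε hL hε _ (fanoK₂_spec Q L ε hL hε N hN).1
    (fanoK₂_spec Q L ε hL hε N hN).2).2

theorem eps_nonneg_of_range {N : ℕ} (hN : 1 - Q.topSum (N * L) ≤ ε) : 0 ≤ ε :=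
  (sub_nonneg.2 (Q.topSum_le_one _)).trans hN

end Fano

/-! ### Random variables with side information -/

section SideInformation

variable {Ω 𝒴 : Type*} [MeasurableSpace Ω] [MeasurableSpace 𝒴]

/-- The regular conditional distribution `P_{X | Y = y}`. -/
noncomputable def condMarginal (μ : Measure Ω) [IsFiniteMeasure μ] (X : Ω → ℕ) (Y : Ω → 𝒴)
    (y : 𝒴) : Marginal :=
  Marginal.ofMeasure (condDistrib X Y μ y)

/-- The generalized conditional information measure `E[φ(P_{X|Y})]`. -/
noncomputable def condInfo (φ : Marginal → ℝ≥0∞) (μ : Measure Ω) [IsFiniteMeasure μ]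
    (X : Ω → ℕ) (Y : Ω → 𝒴) : ℝ≥0∞ :=
  ∫⁻ ω, φ (condMarginal μ X Y (Y ω)) ∂μ

/-- The minimum average error probability of list decoding with list size `L`: the infimum of
`P{X ∉ f(Y)}` over all `f` whose values are nonempty sets of at most `L` symbols. -/
noncomputable def condListError (L : ℕ) (μ : Measure Ω) (X : Ω → ℕ) (Y : Ω → 𝒴) : ℝ :=
  ⨅ f : 𝒴 → {D : Finset ℕ // 1 ≤ D.card ∧ D.card ≤ L}, μ.real {ω | X ω ∉ (f (Y ω)).1}

/-- `X` and `Y` are random variables and `X` has distribution `Q`. -/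
structure HasMarginal (Q : Marginal) (μ : Measure Ω) (X : Ω → ℕ) (Y : Ω → 𝒴) : Prop where
  measurable_fst : Measurable X
  measurable_snd : Measurable Y
  law : ∀ x, μ.real (X ⁻¹' {x}) = Q.mass x

end SideInformation

universe u v

/-- The supremum of `E[φ(P_{X|Y})]` over all pairs `(X, Y)` of random variables, on any
probability space, such that `X` has distribution `Q`, `Y` takes values in `𝒴`, and the minimum
average error probability of list decoding is at most `ε`. -/
noncomputable def supCondInfo (φ : Marginal → ℝ≥0∞) (Q : Marginal) (L : ℕ) (ε : ℝ)
    (𝒴 : Type v) [MeasurableSpace 𝒴] : ℝ≥0∞ :=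
  sSup {h : ℝ≥0∞ | ∃ (Ω : Type u) (_ : MeasurableSpace Ω) (μ : Measure Ω)
    (_ : IsProbabilityMeasure μ) (X : Ω → ℕ) (Y : Ω → 𝒴),
    HasMarginal Q μ X Y ∧ condListError L μ X Y ≤ ε ∧ h = condInfo φ μ X Y}

/-! ### Rearrangements -/

namespace Marginal

/-! Upper bound. `Q` is the finite mixture of the conditional laws of `X` given `Y = y`. Permuting
each law separately leaves its `φ`-value unchanged, so the laws can be sorted into a common order.
The new mixture `M` majorizes `Q`, and its `L` heaviest symbols carry at least `1 - ε`
(`exists_rearranged_mixture`). Jensen's inequality (`IsConcave.sum_le`) bounds the conditional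
information by `φ M`. Fano distributions are minimal for majorization under such constraints: their
partial sums follow those of `Q↓`, then run affinely to `1 - ε` at `L`, then affinely back to those
of `Q↓` at the cut-off. The concave partial sums of a competitor dominate an affine piece as soon as
they do so at its endpoints (`sum_range_add_le_of_endpoints`, `IsFano.topSum_le`). Schur concavity
(`le_of_topSum_le`) finishes.

The size of `𝒴` enters through the sorted block: the optimal lists cover at most `|𝒴| L` symbols,
and off a block of that size `M` is still a relabelled `Q`. This gives extra lower bounds on the top
sums of `M`, needed when the type-2 masses jump up at the cut-off. Since `P₂` itself meets the
constraints defining type 1, `φ P₂ ≤ φ P₁`.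

Attainment. `P₂` majorizes `Q`, so `Q↓` is a convex combination of permutations of `P₂` moving only
the window from `J` to `K₂` (`mem_convexHull_perm_of_sum_range_le`). There `P₂` takes two values, so
a binomial coefficient bounds the number of components; Carathéodory's theorem gives the other bound
(`IsFano.exists_mixture`). Under `(*)` error and information depend only on `P₂↓`; conversely, for
strictly concave `φ`, tightness of Jensen and of Schur concavity forces `(*)`. -/

theorem exists_forall_notMem_mass_le (P : Marginal) (s : Finset ℕ) :
    ∃ x ∉ s, ∀ y ∉ s, P.mass y ≤ P.mass x := by
  by_cases h : ∃ y ∉ s, 0 < P.mass y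
  · obtain ⟨y, hys, hy⟩ := h
    have hfin : {x | P.mass y ≤ P.mass x}.Finite := by
      have := P.hasSum.summable.tendsto_cofinite_zero.eventually (gt_mem_nhds hy)
      simpa [Filter.eventually_cofinite] using this
    obtain ⟨x, hx, hmax⟩ := Set.exists_max_image ({x | P.mass y ≤ P.mass x} \ ↑s) P.mass
      (hfin.subset Set.sdiff_subset) ⟨y, le_refl (P.mass y), hys⟩
    refine ⟨x, hx.2, fun z hz => ?_⟩
    by_cases hyz : P.mass y ≤ P.mass z
    · exact hmax z ⟨hyz, hz⟩
    · exact (not_le.1 hyz).le.trans hx.1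
  · push Not at h
    obtain ⟨x, hx⟩ := Infinite.exists_notMem_finset s
    exact ⟨x, hx, fun y hy => (h y hy).trans (P.nonneg x)⟩

/-- The decreasing rearrangement enumerates the masses along an injection. -/
theorem exists_injective_decMass (P : Marginal) :
    ∃ σ : ℕ → ℕ, σ.Injective ∧ ∀ i, P.decMass i = P.mass (σ i) := by
  choose g hg hmax using P.exists_forall_notMem_mass_le
  -- Greedy enumeration: `F n` holds the first `n` chosen symbols, and `g (F n)` is a heaviest
  -- remaining one.
  obtain ⟨F, hF0, hF⟩ : ∃ F : ℕ → Finset ℕ, F 0 = ∅ ∧ ∀ n, F (n + 1) = insert (g (F n)) (F n) :=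
    ⟨fun n => Nat.rec ∅ (fun _ s => insert (g s) s) n, rfl, fun _ => rfl⟩
  have hFmono : Monotone F := monotone_nat_of_le_succ fun n => by
    rw [hF]
    exact Finset.subset_insert _ _
  have hmem : ∀ {i j}, i < j → g (F i) ∈ F j := fun {i j} hij =>
    hFmono (Nat.succ_le_of_lt hij) (by rw [hF]; exact Finset.mem_insert_self _ _)
  have hcard : ∀ n, (F n).card = n := by
    intro n
    induction n with
    | zero => rw [hF0, Finset.card_empty]
    | succ n ih => rw [hF, Finset.card_insert_of_notMem (hg _), ih]
  have hmemF : ∀ n, ∀ x ∈ F n, ∃ j < n, x = g (F j) := by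
    intro n
    induction n with
    | zero => intro x hx; exact absurd (hF0 ▸ hx) (Finset.notMem_empty x)
    | succ n ih =>
      intro x hx
      rw [hF, Finset.mem_insert] at hx
      rcases hx with rfl | hx
      · exact ⟨n, n.lt_succ_self, rfl⟩
      · obtain ⟨j, hj, rfl⟩ := ih x hx
        exact ⟨j, by omega, rfl⟩
  refine ⟨fun n => g (F n), fun i j hij => ?_, fun n => le_antisymm ?_ ?_⟩
  · simp only at hij
    rcases lt_trichotomy i j with h | h | h
    · exact absurd (hij ▸ hmem h) (hg _)
    · exact h
    · exact absurd (hij ▸ hmem h) (hg _)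
  · refine csSup_le ⟨0, P.zero_mem_decMass n⟩ fun t ht => ?_
    have : ¬ {x | t ≤ P.mass x} ⊆ ↑(F n) := fun hsub => by
      have h1 := le_trans ht (Set.encard_le_encard hsub)
      rw [Set.encard_coe_eq_coe_finsetCard, hcard, Nat.cast_le] at h1
      omega
    obtain ⟨x, hx, hxF⟩ := Set.not_subset.1 this
    exact le_trans hx (hmax _ x hxF)
  · refine le_csSup (P.bddAbove_decMass n) ?_
    have hsub : (↑(F (n + 1)) : Set ℕ) ⊆ {x | P.mass (g (F n)) ≤ P.mass x} := by
      intro x hx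
      obtain ⟨j, hj, rfl⟩ := hmemF _ x hx
      exact hmax _ _ fun h => hg _ (hFmono (by omega : j ≤ n) h)
    have := Set.encard_le_encard hsub
    rwa [Set.encard_coe_eq_coe_finsetCard, hcard] at this

/-- Remove the lightest symbol of `B`: all symbols of `B` weigh at least as much, so its mass is at
most the `|B|`-th largest one. -/
theorem sum_le_topSum (P : Marginal) (B : Finset ℕ) : ∑ x ∈ B, P.mass x ≤ P.topSum B.card := by
  induction h : B.card generalizing B with
  | zero =>
    rw [Finset.card_eq_zero] at h
    simp [h, topSum]
  | succ k ih =>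
    obtain ⟨x, hx, hmin⟩ := Finset.exists_min_image B P.mass (Finset.card_pos.1 (by omega))
    rw [← Finset.sum_erase_add _ _ hx, topSum_succ]
    refine add_le_add (ih _ (by rw [Finset.card_erase_of_mem hx]; omega)) ?_
    refine le_csSup (P.bddAbove_decMass k) ?_
    change ((k + 1 : ℕ) : ℕ∞) ≤ _
    rw [← h, ← Set.encard_coe_eq_coe_finsetCard]
    exact Set.encard_le_encard hmin

theorem exists_sum_eq_topSum (P : Marginal) (k : ℕ) :
    ∃ B : Finset ℕ, B.card = k ∧ ∑ x ∈ B, P.mass x = P.topSum k := by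
  obtain ⟨σ, hσ, h⟩ := P.exists_injective_decMass
  refine ⟨(Finset.range k).image σ, ?_, ?_⟩
  · rw [Finset.card_image_of_injective _ hσ, Finset.card_range]
  · rw [Finset.sum_image fun _ _ _ _ e => hσ e]
    exact Finset.sum_congr rfl fun i _ => (h i).symm

theorem sum_range_le_topSum (P : Marginal) (k : ℕ) :
    ∑ x ∈ Finset.range k, P.mass x ≤ P.topSum k := by
  simpa using P.sum_le_topSum (Finset.range k)

/-- The range of `σ` already carries the total mass `1` of `P`, so nothing is left for `R`
elsewhere. -/
theorem mass_eq_zero_of_notMem_range {P R : Marginal} {σ : ℕ → ℕ} (hσ : σ.Injective)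
    (h : ∀ i, R.mass (σ i) = P.mass i) {x : ℕ} (hx : x ∉ Set.range σ) : R.mass x = 0 := by
  refine le_antisymm ?_ (R.nonneg x)
  have : (1 : ℝ) ≤ 1 - R.mass x := by
    refine hasSum_le_of_sum_le P.hasSum fun s => ?_
    have hx' : x ∉ s.image σ := fun hm => by
      obtain ⟨i, -, rfl⟩ := Finset.mem_image.1 hm
      exact hx ⟨i, rfl⟩
    have := sum_le_hasSum (insert x (s.image σ)) (fun i _ => R.nonneg i) R.hasSum
    rw [Finset.sum_insert hx', Finset.sum_image fun _ _ _ _ e => hσ e] at this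
    simp only [h] at this
    linarith
  linarith

/-- The decreasing rearrangement is invariant under injective relabelling. -/
theorem dec_eq_of_injective {P R : Marginal} {σ : ℕ → ℕ} (hσ : σ.Injective)
    (h : ∀ i, R.mass (σ i) = P.mass i) : R.dec = P.dec := by
  have key : ∀ i t, t < R.decMass i ↔ t < P.decMass i := by
    intro i t
    -- Negative levels are treated apart: symbols off the range of `σ` have mass zero and leave the
    -- superlevel set only when `t ≥ 0`.
    rcases lt_or_ge t 0 with ht | ht
    · exact ⟨fun _ => ht.trans_le (P.decMass_nonneg i), fun _ => ht.trans_le (R.decMass_nonneg i)⟩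
    · have : {x | t < R.mass x} = σ '' {x | t < P.mass x} := by
        ext x
        constructor
        · intro hx
          by_cases hr : x ∈ Set.range σ
          · obtain ⟨j, rfl⟩ := hr
            exact ⟨j, by simpa [h] using hx, rfl⟩
          · have h0 := mass_eq_zero_of_notMem_range hσ h hr
            simp only [Set.mem_ofPred_eq, h0] at hx
            linarith
        · rintro ⟨j, hj, rfl⟩
          simpa [h] using hj
      rw [lt_decMass_iff, lt_decMass_iff, this, hσ.encard_image]
  ext i
  exact eq_of_forall_lt_iff (key i)

theorem decMass_congr {P R : Marginal} (h : P.dec = R.dec) (i : ℕ) : P.decMass i = R.decMass i :=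
  congrFun (congrArg mass h) i

theorem topSum_congr {P R : Marginal} (h : P.dec = R.dec) (k : ℕ) : P.topSum k = R.topSum k :=
  Finset.sum_congr rfl fun i _ => decMass_congr h i

/-- The distribution with masses `P (σ x)`. -/
noncomputable def perm (P : Marginal) (σ : Equiv.Perm ℕ) : Marginal where
  mass x := P.mass (σ x)
  nonneg _ := P.nonneg _
  hasSum := σ.hasSum_iff.2 P.hasSum

theorem dec_perm (P : Marginal) (σ : Equiv.Perm ℕ) : (P.perm σ).dec = P.dec :=
  (dec_eq_of_injective (P := P.perm σ) (R := P) σ.injective fun _ => rfl).symm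

/-- The image of `P` under an injection of the alphabet. -/
noncomputable def push (P : Marginal) (σ : ℕ → ℕ) (hσ : σ.Injective) : Marginal where
  mass := Function.extend σ P.mass 0
  nonneg x := by
    by_cases hx : ∃ i, σ i = x
    · obtain ⟨i, rfl⟩ := hx
      rw [hσ.extend_apply]
      exact P.nonneg i
    · rw [Function.extend_apply' _ _ _ hx, Pi.zero_apply]
  hasSum := by
    have h0 : ∀ x ∉ Set.range σ, Function.extend σ P.mass 0 x = 0 := fun x hx => by
      rw [Function.extend_apply' _ _ _ fun hc => hx hc, Pi.zero_apply]
    rw [← hσ.hasSum_iff h0, Function.extend_comp hσ]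
    exact P.hasSum

theorem push_apply (P : Marginal) {σ : ℕ → ℕ} (hσ : σ.Injective) (i : ℕ) :
    (P.push σ hσ).mass (σ i) = P.mass i :=
  hσ.extend_apply _ _ i

theorem dec_push (P : Marginal) {σ : ℕ → ℕ} (hσ : σ.Injective) : (P.push σ hσ).dec = P.dec :=
  dec_eq_of_injective hσ (P.push_apply hσ)

end Marginal

theorem IsSymmetric.eq_of_dec_eq {φ : Marginal → ℝ≥0∞} (hsymm : IsSymmetric φ) {P R : Marginal}
    (h : P.dec = R.dec) : φ P = φ R := by
  rw [hsymm P, hsymm R, h]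

/-! ### Sums of antitone sequences -/

theorem sub_mul_le_sum_range {d : ℕ → ℝ} (hd : Antitone d) {a b : ℕ} (hab : a ≤ b) :
    ((b : ℝ) - a) * d b ≤ ∑ i ∈ Finset.range b, d i - ∑ i ∈ Finset.range a, d i := by
  rw [← Finset.sum_Ico_eq_sub _ hab, ← Nat.cast_sub hab, ← Nat.card_Ico, ← nsmul_eq_mul]
  refine Finset.card_nsmul_le_sum _ _ _ fun i hi => hd ?_
  rw [Finset.mem_Ico] at hi
  omega

theorem sum_range_le_sub_mul {d : ℕ → ℝ} (hd : Antitone d) {a b : ℕ} (hab : a ≤ b) :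
    ∑ i ∈ Finset.range b, d i - ∑ i ∈ Finset.range a, d i ≤ ((b : ℝ) - a) * d a := by
  rw [← Finset.sum_Ico_eq_sub _ hab, ← Nat.cast_sub hab, ← Nat.card_Ico, ← nsmul_eq_mul]
  refine Finset.sum_le_card_nsmul _ _ _ fun i hi => hd ?_
  rw [Finset.mem_Ico] at hi
  omega

theorem sum_range_eq_of_const {f : ℕ → ℝ} {a m : ℕ} {v : ℝ} (ham : a ≤ m)
    (h : ∀ i, a ≤ i → i < m → f i = v) :
    ∑ i ∈ Finset.range m, f i = ∑ i ∈ Finset.range a, f i + ((m : ℝ) - a) * v := by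
  rw [← Finset.sum_range_add_sum_Ico _ ham, ← Nat.cast_sub ham, ← Nat.card_Ico, ← nsmul_eq_mul,
    ← Finset.sum_const]
  congr 1
  refine Finset.sum_congr rfl fun i hi => ?_
  rw [Finset.mem_Ico] at hi
  exact h i hi.1 hi.2

/-- Comparison of an affine piece of partial sums with concave partial sums. -/
theorem sum_range_add_le_of_endpoints {d f : ℕ → ℝ} (hd : Antitone d) {a m c b : ℕ} {v x : ℝ}
    (ham : a ≤ m) (hmc : m ≤ c) (h : ∀ i, a ≤ i → i < c → f i = v)
    (ha : ∑ i ∈ Finset.range a, f i + x ≤ ∑ i ∈ Finset.range (a + b), d i)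
    (hc : ∑ i ∈ Finset.range c, f i + x ≤ ∑ i ∈ Finset.range (c + b), d i) :
    ∑ i ∈ Finset.range m, f i + x ≤ ∑ i ∈ Finset.range (m + b), d i := by
  have hm := sum_range_eq_of_const ham fun i h1 h2 => h i h1 (by omega)
  have hm' := sum_range_eq_of_const hmc fun i h1 h2 => h i (by omega) h2
  have h1 := sub_mul_le_sum_range hd (by omega : a + b ≤ m + b)
  have h2 := sum_range_le_sub_mul hd (by omega : m + b ≤ c + b)
  push_cast at h1 h2
  have ham' : (a : ℝ) ≤ m := by exact_mod_cast ham
  have hmc' : (m : ℝ) ≤ c := by exact_mod_cast hmc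
  -- If the slope `v` is at most `d (m + b)`, the sums of `d` grow at least as fast from `a` to `m`;
  -- otherwise they grow at most as fast from `m` to `c`, and one argues backwards from `c`.
  rcases le_total v (d (m + b)) with hv | hv
  · have := mul_le_mul_of_nonneg_left hv (sub_nonneg.2 ham')
    linarith
  · have := mul_le_mul_of_nonneg_left hv (sub_nonneg.2 hmc')
    linarith

/-- The largest index in `D` is at least `|D| - 1`. Monotonicity is needed only below `n`, so the
lemma applies to sequences sorted just on an initial block. -/
theorem sum_le_sum_range_card {g : ℕ → ℝ} {n : ℕ} (hg : ∀ i j, i ≤ j → j < n → g j ≤ g i)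
    (D : Finset ℕ) (hD : ∀ i ∈ D, i < n) : ∑ i ∈ D, g i ≤ ∑ i ∈ Finset.range D.card, g i := by
  induction h : D.card generalizing D with
  | zero =>
    rw [Finset.card_eq_zero] at h
    simp [h]
  | succ k ih =>
    have hne : D.Nonempty := Finset.card_pos.1 (by omega)
    have hx := D.max'_mem hne
    rw [← Finset.sum_erase_add _ _ hx, Finset.sum_range_succ]
    refine add_le_add (ih _ (fun i hi => hD i (Finset.mem_of_mem_erase hi))
      (by rw [Finset.card_erase_of_mem hx]; omega)) (hg _ _ ?_ (hD _ hx))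
    by_contra hc
    have hsub : D ⊆ Finset.range k := fun i hi => by
      have := D.le_max' i hi
      rw [Finset.mem_range]
      omega
    have := Finset.card_le_card hsub
    rw [Finset.card_range] at this
    omega

/-! ### Jensen's inequality for finite mixtures -/

section Jensen

variable {ι : Type*}

/-- The finite mixture `∑ w i P i`. -/
noncomputable def Marginal.mixture (s : Finset ι) (w : ι → ℝ) (P : ι → Marginal)
    (hw : ∀ i ∈ s, 0 ≤ w i) (hsum : ∑ i ∈ s, w i = 1) : Marginal where
  mass x := ∑ i ∈ s, w i * (P i).mass x
  nonneg x := Finset.sum_nonneg fun i hi => mul_nonneg (hw i hi) ((P i).nonneg x)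
  hasSum := by
    have := hasSum_sum (s := s) fun i _ => (P i).hasSum.mul_left (w i)
    simpa [hsum] using this

/-- Splitting off one component and renormalizing the others reduces finite mixtures to two-point
concavity. -/
theorem Marginal.exists_eq_mix [DecidableEq ι] {s : Finset ι} {w : ι → ℝ} {P : ι → Marginal}
    (hw : ∀ i ∈ s, 0 ≤ w i) (hsum : ∑ i ∈ s, w i = 1) {M : Marginal}
    (hM : ∀ x, M.mass x = ∑ i ∈ s, w i * (P i).mass x) {i : ι} (hi : i ∈ s) (h1 : w i < 1) :
    ∃ M' : Marginal, (∀ x, M'.mass x = ∑ j ∈ s.erase i, w j / (1 - w i) * (P j).mass x) ∧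
      (∀ j ∈ s.erase i, 0 ≤ w j / (1 - w i)) ∧ ∑ j ∈ s.erase i, w j / (1 - w i) = 1 ∧
      M = Marginal.mix (w i) ⟨hw i hi, h1.le⟩ (P i) M' := by
  have hpos : 0 < 1 - w i := sub_pos.2 h1
  have hw' : ∀ j ∈ s.erase i, 0 ≤ w j / (1 - w i) := fun j hj =>
    div_nonneg (hw j (Finset.mem_of_mem_erase hj)) hpos.le
  have hsum' : ∑ j ∈ s.erase i, w j / (1 - w i) = 1 := by
    rw [← Finset.sum_div, div_eq_one_iff_eq hpos.ne', ← hsum, ← Finset.sum_erase_add _ _ hi]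
    ring
  refine ⟨Marginal.mixture _ _ P hw' hsum', fun _ => rfl, hw', hsum', ?_⟩
  ext x
  change M.mass x = w i * (P i).mass x
    + (1 - w i) * ∑ j ∈ s.erase i, w j / (1 - w i) * (P j).mass x
  rw [hM, ← Finset.add_sum_erase _ _ hi, Finset.mul_sum]
  congr 1
  refine Finset.sum_congr rfl fun j _ => ?_
  field_simp

theorem sum_ofReal_eq_mul_sum_div {s : Finset ι} {w : ι → ℝ} {c : ℝ} (hc : 0 < c)
    (f : ι → ℝ≥0∞) :
    ∑ i ∈ s, ENNReal.ofReal (w i) * f i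
      = ENNReal.ofReal c * ∑ i ∈ s, ENNReal.ofReal (w i / c) * f i := by
  rw [Finset.mul_sum]
  refine Finset.sum_congr rfl fun i _ => ?_
  rw [← mul_assoc, ← ENNReal.ofReal_mul hc.le, mul_div_cancel₀ _ hc.ne']

/-- The degenerate case, in which the remaining weights cannot be renormalized. -/
theorem eq_of_weight_eq_one [DecidableEq ι] {s : Finset ι} {w : ι → ℝ} {P : ι → Marginal}
    (hw : ∀ i ∈ s, 0 ≤ w i) (hsum : ∑ i ∈ s, w i = 1) {M : Marginal}
    (hM : ∀ x, M.mass x = ∑ i ∈ s, w i * (P i).mass x) {i : ι} (hi : i ∈ s) (h1 : w i = 1) :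
    (∀ j ∈ s.erase i, w j = 0) ∧ M = P i := by
  rw [← Finset.add_sum_erase _ _ hi, h1] at hsum
  have h0 : ∀ j ∈ s.erase i, w j = 0 :=
    (Finset.sum_eq_zero_iff_of_nonneg fun j hj => hw j (Finset.mem_of_mem_erase hj)).1
      (by linarith)
  refine ⟨h0, ?_⟩
  ext x
  rw [hM, ← Finset.add_sum_erase _ _ hi, h1, one_mul,
    Finset.sum_eq_zero fun j hj => by rw [h0 j hj, zero_mul], add_zero]

variable {φ : Marginal → ℝ≥0∞}

theorem IsConcave.sum_le (hconc : IsConcave φ) {s : Finset ι} {w : ι → ℝ} {P : ι → Marginal}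
    (hw : ∀ i ∈ s, 0 ≤ w i) (hsum : ∑ i ∈ s, w i = 1) {M : Marginal}
    (hM : ∀ x, M.mass x = ∑ i ∈ s, w i * (P i).mass x) :
    ∑ i ∈ s, ENNReal.ofReal (w i) * φ (P i) ≤ φ M := by
  classical
  induction s using Finset.induction_on generalizing w M with
  | empty => simp
  | insert a s ha ih =>
    have hmem := Finset.mem_insert_self a s
    have herase : (insert a s).erase a = s := Finset.erase_insert ha
    rw [Finset.sum_insert ha]
    have hwa : w a ≤ 1 := by
      rw [← hsum]
      exact Finset.single_le_sum hw hmem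
    rcases hwa.eq_or_lt with h1 | h1
    · obtain ⟨h0, rfl⟩ := eq_of_weight_eq_one hw hsum hM hmem h1
      rw [herase] at h0
      rw [Finset.sum_eq_zero fun j hj => by rw [h0 j hj, ENNReal.ofReal_zero, zero_mul], h1]
      simp
    · obtain ⟨M', hM', hw', hsum', rfl⟩ := Marginal.exists_eq_mix hw hsum hM hmem h1
      rw [herase] at hM' hw' hsum'
      refine le_trans ?_ (hconc _ _ _ ⟨hw a hmem, h1.le⟩)
      rw [sum_ofReal_eq_mul_sum_div (sub_pos.2 h1)]
      gcongr
      exact ih hw' hsum' hM'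

/-- The equality case of Jensen's inequality. -/
theorem IsConcave.eq_of_le_sum (hconc : IsConcave φ) (hstrict : IsStrictConcave φ)
    {s : Finset ι} {w : ι → ℝ} {P : ι → Marginal}
    (hw : ∀ i ∈ s, 0 ≤ w i) (hsum : ∑ i ∈ s, w i = 1) {M : Marginal}
    (hM : ∀ x, M.mass x = ∑ i ∈ s, w i * (P i).mass x) (hfin : φ M ≠ ∞)
    (hle : φ M ≤ ∑ i ∈ s, ENNReal.ofReal (w i) * φ (P i)) {i : ι} (hi : i ∈ s)
    (hpos : w i ≠ 0) : P i = M := by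
  classical
  have hwi : 0 < w i := lt_of_le_of_ne (hw i hi) hpos.symm
  have hwi1 : w i ≤ 1 := by
    rw [← hsum]
    exact Finset.single_le_sum hw hi
  rcases hwi1.eq_or_lt with h1 | h1
  · exact (eq_of_weight_eq_one hw hsum hM hi h1).2.symm
  · obtain ⟨M', hM', hw', hsum', hmix⟩ := Marginal.exists_eq_mix hw hsum hM hi h1
    by_contra hne
    have hPM : P i ≠ M' := by
      rintro rfl
      apply hne
      rw [hmix]
      ext x
      simp only [Marginal.mix]
      ring
    -- Strictness is available only at finite values; as both weights are positive, finiteness of `φ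
    -- M` passes to both parts.
    have hc := hconc (P i) M' (w i) ⟨hwi.le, h1.le⟩
    rw [← hmix] at hc
    have hsumfin := ne_top_of_le_ne_top hfin hc
    have hfin1 : φ (P i) ≠ ∞ := fun h => by
      rw [h, ENNReal.mul_top (by simpa using hwi), top_add] at hsumfin
      exact hsumfin rfl
    have hfin2 : φ M' ≠ ∞ := fun h => by
      rw [h, ENNReal.mul_top (by simpa using h1), add_top] at hsumfin
      exact hsumfin rfl
    have hlt := hstrict (P i) M' (w i) ⟨hwi, h1⟩ hPM hfin1 hfin2
    rw [← hmix] at hlt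
    refine absurd (hlt.trans_le hle) (not_lt.2 ?_)
    rw [← Finset.add_sum_erase _ _ hi, sum_ofReal_eq_mul_sum_div (sub_pos.2 h1)]
    gcongr
    exact hconc.sum_le hw' hsum' hM'

theorem sum_ofReal_mul_const {s : Finset ι} {w : ι → ℝ} (hw : ∀ i ∈ s, 0 ≤ w i)
    (hsum : ∑ i ∈ s, w i = 1) (c : ℝ≥0∞) : ∑ i ∈ s, ENNReal.ofReal (w i) * c = c := by
  rw [← Finset.sum_mul, ← ENNReal.ofReal_sum_of_nonneg hw, hsum, ENNReal.ofReal_one, one_mul]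

end Jensen

/-! ### Majorization -/

/-- The Hardy–Littlewood–Pólya theorem: a decreasing sequence whose partial sums are dominated is
a convex combination of permutations, which moreover fix all places of agreement. -/
theorem mem_convexHull_perm_of_sum_range_le {p q : ℕ → ℝ} {n : ℕ}
    (hq : ∀ i j, i ≤ j → j < n → q j ≤ q i) (htail : ∀ i, n ≤ i → p i = q i)
    (hle : ∀ k ≤ n, ∑ i ∈ Finset.range k, q i ≤ ∑ i ∈ Finset.range k, p i)
    (heq : ∑ i ∈ Finset.range n, p i = ∑ i ∈ Finset.range n, q i) :
    q ∈ convexHull ℝ {r | ∃ σ : Equiv.Perm ℕ, (∀ i, p i = q i → σ i = i) ∧ r = p ∘ σ} := by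
  -- Induction on the number of disagreements; one transfer of mass between two places removes at
  -- least one.
  induction hN : ((Finset.range n).filter fun i => p i ≠ q i).card using Nat.strong_induction_on
    generalizing p with
  | _ N ih =>
  by_cases hall : ∀ i < n, q i ≤ p i
  · have hpq : p = q := by
      funext i
      rcases lt_or_ge i n with hi | hi
      · have h0 := (Finset.sum_eq_sum_iff_of_le fun i hi => hall i (Finset.mem_range.1 hi)).1 heq.symm
        exact (h0 i (Finset.mem_range.2 hi)).symm
      · exact htail i hi
    exact subset_convexHull ℝ _ ⟨1, fun _ _ => rfl, by simp [hpq]⟩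
  -- `k` is the first deficit of `p`. Domination of the partial sums at `k + 1` forces a surplus at
  -- some earlier `j`.
  obtain ⟨k, ⟨hkn, hk⟩, hkmin⟩ : ∃ k, (k < n ∧ p k < q k) ∧ ∀ i < k, q i ≤ p i := by
    push Not at hall
    classical
    refine ⟨Nat.find hall, Nat.find_spec hall, fun i hi => not_lt.1 fun hc => ?_⟩
    exact Nat.find_min hall hi ⟨hi.trans (Nat.find_spec hall).1, hc⟩
  obtain ⟨j, hjk, hj⟩ : ∃ j < k, q j < p j := by
    by_contra! hc
    have h1 := hle (k + 1) hkn
    rw [Finset.sum_range_succ, Finset.sum_range_succ] at h1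
    have h2 := Finset.sum_le_sum fun i hi => hc i (Finset.mem_range.1 hi)
    linarith
  -- The largest transfer from `j` to `k` that overshoots at neither place; it creates agreement at
  -- one of them.
  set δ := min (p j - q j) (q k - p k) with hδ
  have hδj : δ ≤ p j - q j := min_le_left _ _
  have hδk : δ ≤ q k - p k := min_le_right _ _
  have hδ0 : 0 < δ := lt_min (sub_pos.2 hj) (sub_pos.2 hk)
  have hqjk : q k ≤ q j := hq j k hjk.le hkn
  have hgap : 0 < p j - p k := by linarith
  set p' : ℕ → ℝ := fun i => p i + (if i = j then -δ else 0) + (if i = k then δ else 0) with hp'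
  have hp'j : p' j = p j - δ := by simp [hp', hjk.ne, sub_eq_add_neg]
  have hp'k : p' k = p k + δ := by simp [hp', hjk.ne']
  have hp'ne : ∀ i, i ≠ j → i ≠ k → p' i = p i := fun i h1 h2 => by simp [hp', h1, h2]
  have hsum' : ∀ m, ∑ i ∈ Finset.range m, p' i
      = ∑ i ∈ Finset.range m, p i + (if j < m then -δ else 0) + (if k < m then δ else 0) := by
    intro m
    simp only [hp', Finset.sum_add_distrib, Finset.sum_ite_eq', Finset.mem_range]
  have hagree : ∀ i, p i = q i → i ≠ j ∧ i ≠ k := fun i hi =>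
    ⟨fun h => by subst h; exact hj.ne hi.symm, fun h => by subst h; exact hk.ne hi⟩
  have hagree' : ∀ i, p i = q i → p' i = q i := fun i hi => by
    rw [hp'ne i (hagree i hi).1 (hagree i hi).2, hi]
  have hmem := ih (p := p') _ ?_ (fun i hi => hagree' i (htail i hi)) ?_ ?_ rfl
  · refine convexHull_min ?_ (convex_convexHull ℝ _) hmem
    rintro _ ⟨σ, hσ, rfl⟩
    have hl1 : δ / (p j - p k) ≤ 1 := (div_le_one hgap).2 (by linarith)
    have hmul : δ / (p j - p k) * (p j - p k) = δ := div_mul_cancel₀ _ hgap.ne'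
    -- The transfer averages `p` with its transposition at `j` and `k`.
    have hcomb : p' ∘ σ = (1 - δ / (p j - p k)) • (p ∘ σ)
        + (δ / (p j - p k)) • (p ∘ (Equiv.swap j k * σ : Equiv.Perm ℕ)) := by
      funext i
      simp only [Function.comp_apply, Pi.add_apply, Pi.smul_apply, smul_eq_mul,
        Equiv.Perm.mul_apply]
      by_cases h1 : σ i = j
      · rw [h1, Equiv.swap_apply_left, hp'j]
        linarith
      · by_cases h2 : σ i = k
        · rw [h2, Equiv.swap_apply_right, hp'k]
          linarith
        · rw [Equiv.swap_apply_of_ne_of_ne h1 h2, hp'ne _ h1 h2]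
          ring
    rw [hcomb]
    refine convex_convexHull ℝ _ (subset_convexHull ℝ _ ?_) (subset_convexHull ℝ _ ?_)
      (by linarith) (div_nonneg hδ0.le hgap.le) (by ring)
    · exact ⟨σ, fun i hi => hσ i (hagree' i hi), rfl⟩
    refine ⟨Equiv.swap j k * σ, fun i hi => ?_, rfl⟩
    rw [Equiv.Perm.mul_apply, hσ i (hagree' i hi),
      Equiv.swap_apply_of_ne_of_ne (hagree i hi).1 (hagree i hi).2]
  · rw [← hN]
    refine Finset.card_lt_card (Finset.ssubset_iff_of_subset ?_ |>.2 ?_)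
    · intro i hi
      rw [Finset.mem_filter] at hi ⊢
      exact ⟨hi.1, fun h => hi.2 (hagree' i h)⟩
    · rcases min_choice (p j - q j) (q k - p k) with h | h
      · refine ⟨j, Finset.mem_filter.2 ⟨Finset.mem_range.2 (hjk.trans hkn), hj.ne'⟩, fun hc => ?_⟩
        refine (Finset.mem_filter.1 hc).2 ?_
        rw [hp'j, hδ, h]
        ring
      · refine ⟨k, Finset.mem_filter.2 ⟨Finset.mem_range.2 hkn, hk.ne⟩, fun hc => ?_⟩
        refine (Finset.mem_filter.1 hc).2 ?_
        rw [hp'k, hδ, h]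
        ring
  · intro m hm
    rw [hsum']
    rcases le_or_gt m j with h1 | h1
    · rw [if_neg (by omega), if_neg (by omega)]
      linarith [hle m hm]
    · rcases le_or_gt m k with h2 | h2
      · rw [if_pos h1, if_neg (by omega)]
        -- No deficit occurs before `k`, so the slack at `m` includes the whole surplus at `j` and
        -- absorbs `δ`.
        have h3 : p j - q j ≤ ∑ i ∈ Finset.range m, (p i - q i) :=
          Finset.single_le_sum (f := fun i => p i - q i) (fun i hi => sub_nonneg.2
            (hkmin i (by rw [Finset.mem_range] at hi; omega))) (Finset.mem_range.2 h1)
        rw [Finset.sum_sub_distrib] at h3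
        linarith
      · rw [if_pos h1, if_pos h2]
        linarith [hle m hm]
  · rw [hsum', if_pos (hjk.trans hkn), if_pos hkn]
    linarith

theorem Marginal.sum_range_eq_of_eq_tail {P Q : Marginal} {n : ℕ}
    (htail : ∀ i, n ≤ i → P.mass i = Q.mass i) :
    ∑ i ∈ Finset.range n, P.mass i = ∑ i ∈ Finset.range n, Q.mass i := by
  have h1 := P.hasSum.summable.sum_add_tsum_nat_add n
  have h2 := Q.hasSum.summable.sum_add_tsum_nat_add n
  rw [P.hasSum.tsum_eq] at h1
  rw [Q.hasSum.tsum_eq] at h2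
  have : ∀ i, P.mass (i + n) = Q.mass (i + n) := fun i => htail _ (by omega)
  simp only [this] at h1
  linarith

/-! ### Schur concavity of symmetric concave functionals -/

section Schur

variable {φ : Marginal → ℝ≥0∞}

/-- Here `Q` is a convex combination of permutations of `P`, all with the same `φ`-value, so Jensen
applies. No semicontinuity is needed for a common tail. -/
theorem le_of_eq_tail (hsymm : IsSymmetric φ) (hconc : IsConcave φ) {P Q : Marginal} {n : ℕ}
    (hQ : ∀ i j, i ≤ j → j < n → Q.mass j ≤ Q.mass i) (htail : ∀ i, n ≤ i → P.mass i = Q.mass i)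
    (hle : ∀ k ≤ n, ∑ i ∈ Finset.range k, Q.mass i ≤ ∑ i ∈ Finset.range k, P.mass i) :
    φ P ≤ φ Q := by
  obtain ⟨ι, _, z, w, hz, -, hw, hsum, hzQ⟩ := eq_pos_convex_span_of_mem_convexHull
    (mem_convexHull_perm_of_sum_range_le hQ htail hle
      (Marginal.sum_range_eq_of_eq_tail htail))
  choose σ _ hσ using fun i => hz ⟨i, rfl⟩
  have := hconc.sum_le (s := Finset.univ) (w := w) (P := fun i => P.perm (σ i)) (M := Q)
    (fun i _ => (hw i).le) hsum fun x => by
      rw [← hzQ, Finset.sum_apply]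
      refine Finset.sum_congr rfl fun i _ => ?_
      rw [hσ, Pi.smul_apply, smul_eq_mul]
      rfl
  simp only [hsymm.eq_of_dec_eq (P.dec_perm _)] at this
  rwa [sum_ofReal_mul_const (fun i _ => (hw i).le) hsum] at this

/-- Schur concavity. -/
theorem le_of_sum_range_le (hsymm : IsSymmetric φ) (hconc : IsConcave φ)
    (hlsc : IsLowerSemicont φ) {P Q : Marginal} (hQ : Antitone Q.mass)
    (hle : ∀ k, ∑ i ∈ Finset.range k, Q.mass i ≤ ∑ i ∈ Finset.range k, P.mass i) :
    φ P ≤ φ Q := by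
  set A : ℕ → ℝ := fun k => ∑ i ∈ Finset.range k, P.mass i with hA
  set s : ℕ → ℝ := fun k => ∑ i ∈ Finset.range k, Q.mass i with hs
  have hAsucc : ∀ k, A (k + 1) = A k + P.mass k := fun k => Finset.sum_range_succ _ _
  have hssucc : ∀ k, s (k + 1) = s k + Q.mass k := fun k => Finset.sum_range_succ _ _
  have hsmono : Monotone s := monotone_nat_of_le_succ fun k => by
    rw [hssucc]; linarith [Q.nonneg k]
  have hAle : ∀ k, A k ≤ 1 := fun k => sum_le_hasSum _ (fun i _ => P.nonneg i) P.hasSum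
  -- Approximants of `P`: follow `P` until the mass `s n` of the first `n` symbols under `Q` is used
  -- up, then continue as `Q` from `n` on. They share a tail with `Q`, still majorize it, and
  -- converge to `P` because `s n → 1`.
  let f : ℕ → ℕ → ℝ := fun n k =>
    if k < n then min (A (k + 1)) (s n) - min (A k) (s n) else Q.mass k
  have hs0 : ∀ n, 0 ≤ s n := fun n => Finset.sum_nonneg fun i _ => Q.nonneg i
  have hpre : ∀ n, ∀ k ≤ n, ∑ i ∈ Finset.range k, f n i = min (A k) (s n) := by
    intro n k hk
    have h1 : ∑ i ∈ Finset.range k, f n i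
        = ∑ i ∈ Finset.range k, (min (A (i + 1)) (s n) - min (A i) (s n)) := by
      refine Finset.sum_congr rfl fun i hi => ?_
      rw [Finset.mem_range] at hi
      exact if_pos (by omega)
    rw [h1, Finset.sum_range_sub fun i => min (A i) (s n)]
    have : A 0 = 0 := by simp [hA]
    rw [this, min_eq_left (hs0 n), sub_zero]
  let p : ℕ → Marginal := fun n =>
    { mass := f n
      nonneg := fun k => by
        simp only [f]
        split_ifs
        · rw [sub_nonneg, hAsucc]
          exact min_le_min_right _ (by linarith [P.nonneg k])
        · exact Q.nonneg k
      hasSum := by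
        have hdiff : HasSum (fun i => f n i - Q.mass i)
            (∑ i ∈ Finset.range n, (f n i - Q.mass i)) := by
          refine hasSum_sum_of_ne_finset_zero fun i hi => ?_
          rw [Finset.mem_range] at hi
          simp [f, hi]
        rw [Finset.sum_sub_distrib, hpre n n le_rfl, min_eq_right (hle n), sub_self] at hdiff
        simpa using hdiff.add Q.hasSum }
  have hp : ∀ n, φ (p n) ≤ φ Q := fun n => by
    refine le_of_eq_tail hsymm hconc (n := n) (fun i j hij _ => hQ hij)
      (fun i hi => if_neg (not_lt.2 hi)) fun k hk => ?_
    change s k ≤ ∑ i ∈ Finset.range k, f n i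
    rw [hpre n k hk]
    exact le_min (hle k) (hsmono hk)
  have hslim : Tendsto s atTop (𝓝 1) := Q.hasSum.tendsto_sum_nat
  have hlim : ∀ x, Tendsto (fun n => (p n).mass x) atTop (𝓝 (P.mass x)) := fun x => by
    have h1 := ((tendsto_const_nhds (x := A (x + 1))).min hslim).sub
      ((tendsto_const_nhds (x := A x)).min hslim)
    rw [min_eq_left (hAle _), min_eq_left (hAle _), hAsucc, add_sub_cancel_left] at h1
    refine h1.congr' ?_
    filter_upwards [eventually_gt_atTop x] with n hn
    rw [← hAsucc]
    exact (if_pos hn).symm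
  refine (hlsc P p hlim).trans ?_
  calc liminf (fun n => φ (p n)) atTop ≤ liminf (fun _ : ℕ => φ Q) atTop :=
        liminf_le_liminf (Eventually.of_forall hp)
    _ = φ Q := liminf_const _

/-- Schur concavity in terms of decreasing rearrangements. -/
theorem le_of_topSum_le (hsymm : IsSymmetric φ) (hconc : IsConcave φ)
    (hlsc : IsLowerSemicont φ) {P Q : Marginal} (hle : ∀ k, Q.topSum k ≤ P.topSum k) :
    φ P ≤ φ Q := by
  rw [hsymm P, hsymm Q]
  exact le_of_sum_range_le hsymm hconc hlsc Q.decMass_antitone hle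

/-- Strict Schur concavity. -/
theorem dec_eq_of_topSum_le (hsymm : IsSymmetric φ) (hconc : IsConcave φ)
    (hlsc : IsLowerSemicont φ) (hstrict : IsStrictConcave φ) {P Q : Marginal}
    (hle : ∀ k, Q.topSum k ≤ P.topSum k) (hfin : φ Q ≠ ∞) (hφ : φ P = φ Q) :
    P.dec = Q.dec := by
  by_contra hne
  -- The midpoint of `P↓` and `Q↓` still majorizes `Q`, so its `φ`-value is at most `φ Q`; strict
  -- concavity would make it larger.
  have hhalf : (1 / 2 : ℝ) ∈ Set.Ioo (0 : ℝ) 1 := by norm_num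
  have h1 := hstrict P.dec Q.dec _ hhalf hne (by rwa [← hsymm, hφ]) (by rwa [← hsymm])
  rw [← hsymm, ← hsymm, hφ, ← add_mul, ← ENNReal.ofReal_add (by norm_num) (by norm_num),
    add_sub_cancel, ENNReal.ofReal_one, one_mul] at h1
  refine absurd h1 (not_lt.2 ?_)
  rw [hsymm Q]
  refine le_of_sum_range_le hsymm hconc hlsc Q.decMass_antitone fun k => ?_
  have h2 := hle k
  simp only [Marginal.mix, Finset.sum_add_distrib, ← Finset.mul_sum]
  change Q.topSum k ≤ 1 / 2 * P.topSum k + (1 - 1 / 2) * Q.topSum k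
  linarith

end Schur

/-! ### Shape of the Fano distributions -/

theorem Marginal.topSum_eq_of_antitone {P : Marginal} (hP : Antitone P.mass) (k : ℕ) :
    P.topSum k = ∑ i ∈ Finset.range k, P.mass i := by
  refine le_antisymm ?_ (P.sum_range_le_topSum k)
  obtain ⟨B, hB, hs⟩ := P.exists_sum_eq_topSum k
  rw [← hs, ← hB]
  exact sum_le_sum_range_card (n := B.sup id + 1) (fun i j hij _ => hP hij) B
    fun i hi => Nat.lt_succ_of_le (Finset.le_sup (f := id) hi)

theorem Marginal.topSum_mono (P : Marginal) : Monotone P.topSum := fun _ _ h =>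
  Finset.sum_le_sum_of_subset_of_nonneg (Finset.range_mono h) fun i _ _ => P.decMass_nonneg i

/-- The first `L` masses of a Fano distribution: `Q↓` up to `a`, then constant, with sum `c`. -/
structure IsFanoHead (Q : Marginal) (a L : ℕ) (V c : ℝ) (f : ℕ → ℝ) : Prop where
  le_L : a ≤ L
  eq_decMass : ∀ i < a, f i = Q.decMass i
  eq_V : ∀ i, a ≤ i → i < L → f i = V
  sum_eq : ∑ i ∈ Finset.range L, f i = c
  decMass_le_V : a < L → Q.decMass a ≤ V
  V_le_decMass : a < L → ∀ i < a, V ≤ Q.decMass i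

/-- A Fano distribution with a finite upper cut-off `K`: constant between `L` and `K`, and equal
to `Q↓` from `K` on. -/
structure IsFano (Q : Marginal) (a L K : ℕ) (V W c : ℝ) (f : ℕ → ℝ) : Prop
    extends IsFanoHead Q a L V c f where
  le_K : L ≤ K
  eq_W : ∀ i, L ≤ i → i < K → f i = W
  W_le_decMass : ∀ i, L ≤ i → i < K → W ≤ Q.decMass i
  eq_tail : ∀ i, K ≤ i → f i = Q.decMass i
  sum_K_eq : ∑ i ∈ Finset.range K, f i = Q.topSum K

namespace IsFanoHead

variable {Q : Marginal} {a L : ℕ} {V c : ℝ} {f : ℕ → ℝ}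

theorem decMass_le (h : IsFanoHead Q a L V c f) {i j : ℕ} (hij : i ≤ j) (hi : i < L) :
    Q.decMass j ≤ f i := by
  rcases lt_or_ge i a with hia | hia
  · rw [h.eq_decMass i hia]
    exact Q.decMass_antitone hij
  · rw [h.eq_V i hia hi]
    exact (Q.decMass_antitone (hia.trans hij)).trans (h.decMass_le_V (by omega))

theorem antitone (h : IsFanoHead Q a L V c f) {i j : ℕ} (hij : i ≤ j) (hj : j < L) :
    f j ≤ f i := by
  rcases lt_or_ge j a with hja | hja
  · rw [h.eq_decMass j hja]
    exact h.decMass_le hij (by omega)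
  · rw [h.eq_V j hja hj]
    rcases lt_or_ge i a with hia | hia
    · rw [h.eq_decMass i hia]
      exact h.V_le_decMass (by omega) i hia
    · rw [h.eq_V i hia (by omega)]

theorem sum_range_eq_topSum (h : IsFanoHead Q a L V c f) {m : ℕ} (hm : m ≤ a) :
    ∑ i ∈ Finset.range m, f i = Q.topSum m :=
  Finset.sum_congr rfl fun i hi => h.eq_decMass i (by rw [Finset.mem_range] at hi; omega)

theorem topSum_le_sum_range (h : IsFanoHead Q a L V c f) {m : ℕ} (hm : m ≤ L) :
    Q.topSum m ≤ ∑ i ∈ Finset.range m, f i :=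
  Finset.sum_le_sum fun i hi =>
    h.decMass_le le_rfl (by rw [Finset.mem_range] at hi; omega)

/-- The partial sums are those of `Q↓` up to `a` and affine from `a` to `L`, so beyond `a` only the
endpoints matter. -/
theorem sum_range_add_le (h : IsFanoHead Q a L V c f) {R : Marginal} {b : ℕ} {x : ℝ}
    (hQ : ∀ m ≤ a, Q.topSum m + x ≤ R.topSum (m + b)) (hL : c + x ≤ R.topSum (L + b))
    {m : ℕ} (hm : m ≤ L) : ∑ i ∈ Finset.range m, f i + x ≤ R.topSum (m + b) := by
  rcases le_total m a with hma | hma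
  · rw [h.sum_range_eq_topSum hma]
    exact hQ m hma
  · refine sum_range_add_le_of_endpoints R.decMass_antitone hma hm h.eq_V ?_ ?_
    · rw [h.sum_range_eq_topSum le_rfl]
      exact hQ a le_rfl
    · rw [h.sum_eq]
      exact hL

end IsFanoHead

namespace IsFano

variable {Q : Marginal} {a L K : ℕ} {V W c : ℝ} {f : ℕ → ℝ}

theorem antitone_of_lt (h : IsFano Q a L K V W c f) {i j : ℕ} (hij : i ≤ j) (hj : j < K) :
    f j ≤ f i := by
  rcases lt_or_ge j L with hjL | hjL
  · exact h.antitone hij hjL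
  · rw [h.eq_W j hjL hj]
    rcases lt_or_ge i L with hiL | hiL
    · exact (h.W_le_decMass j hjL hj).trans (h.decMass_le hij hiL)
    · rw [h.eq_W i hiL (by omega)]

/-- The only possible failure of monotonicity is an upward jump at `K`, which `hW` excludes. -/
theorem antitone_of_decMass_le (h : IsFano Q a L K V W c f) (hW : L < K → Q.decMass K ≤ W) :
    Antitone f := by
  intro i j hij
  rcases lt_or_ge j K with hj | hj
  · exact h.antitone_of_lt hij hj
  · rw [h.eq_tail j hj]
    rcases lt_or_ge i L with hiL | hiL
    · exact h.decMass_le hij hiL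
    · rcases lt_or_ge i K with hiK | hiK
      · rw [h.eq_W i hiL hiK]
        exact (Q.decMass_antitone hj).trans (hW (by omega))
      · rw [h.eq_tail i hiK]
        exact Q.decMass_antitone hij

theorem sum_range_eq_topSum_of_le (h : IsFano Q a L K V W c f) {m : ℕ} (hm : K ≤ m) :
    ∑ i ∈ Finset.range m, f i = Q.topSum m := by
  rw [Marginal.topSum, ← Finset.sum_range_add_sum_Ico _ hm, h.sum_K_eq,
    ← Finset.sum_range_add_sum_Ico Q.decMass hm, Marginal.topSum]
  congr 1
  exact Finset.sum_congr rfl fun i hi => h.eq_tail i (Finset.mem_Ico.1 hi).1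

/-- The head lies above `Q↓` and the plateau below it, so the surplus of the partial sums grows up
to `L` and then falls to zero at `K`. -/
theorem topSum_le_sum (h : IsFano Q a L K V W c f) (m : ℕ) :
    Q.topSum m ≤ ∑ i ∈ Finset.range m, f i := by
  rcases le_total m L with hmL | hmL
  · exact h.topSum_le_sum_range hmL
  rcases le_total K m with hKm | hKm
  · exact (h.sum_range_eq_topSum_of_le hKm).ge
  · have h1 := h.sum_K_eq
    rw [Marginal.topSum, ← Finset.sum_range_add_sum_Ico _ hKm,
      ← Finset.sum_range_add_sum_Ico Q.decMass hKm] at h1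
    have h2 : ∑ i ∈ Finset.Ico m K, f i ≤ ∑ i ∈ Finset.Ico m K, Q.decMass i := by
      refine Finset.sum_le_sum fun i hi => ?_
      rw [Finset.mem_Ico] at hi
      rw [h.eq_W i (by omega) hi.2]
      exact h.W_le_decMass i (by omega) hi.2
    rw [Marginal.topSum]
    linarith

/-- Allows for `b` tail symbols selected together with the first `m`. The sums are piecewise affine
after `a`, so it suffices to check `m ≤ a`, `m = L` and `m = K`. -/
theorem sum_range_add_le_topSum (h : IsFano Q a L K V W c f) {R : Marginal} {b : ℕ}
    (hQ : ∀ k, Q.topSum k ≤ R.topSum k)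
    (hL : c + (Q.topSum (K + b) - Q.topSum K) ≤ R.topSum (L + b)) {m : ℕ} (hm : m ≤ K) :
    ∑ i ∈ Finset.range m, f i + (Q.topSum (K + b) - Q.topSum K) ≤ R.topSum (m + b) := by
  have hshift : ∀ m ≤ K, Q.topSum m + (Q.topSum (K + b) - Q.topSum K) ≤ Q.topSum (m + b) := by
    intro m hm
    simp only [Marginal.topSum, Finset.sum_range_add, add_sub_cancel_left]
    gcongr with i
    exact Q.decMass_antitone (by omega)
  rcases le_total m L with hmL | hmL
  · exact h.sum_range_add_le (fun k hk =>
      (hshift k (hk.trans (h.le_L.trans h.le_K))).trans (hQ _)) hL hmL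
  · refine sum_range_add_le_of_endpoints R.decMass_antitone hmL hm h.eq_W ?_ ?_
    · rw [h.sum_eq]
      exact hL
    · rw [h.sum_K_eq]
      exact (hshift K le_rfl).trans (hQ _)

/-- Every distribution that majorizes `Q` and has large enough sums of masses majorizes the Fano
distribution. -/
theorem topSum_le (h : IsFano Q a L K V W c f) {P R : Marginal} (hP : P.mass = f)
    (hQ : ∀ k, Q.topSum k ≤ R.topSum k) (hc : c ≤ R.topSum L)
    (hor : (L < K → Q.decMass K ≤ W) ∨
      ∀ b, c + (Q.topSum (K + b) - Q.topSum K) ≤ R.topSum (L + b)) (k : ℕ) :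
    P.topSum k ≤ R.topSum k := by
  rcases hor with hW | hb
  · rw [Marginal.topSum_eq_of_antitone (by rw [hP]; exact h.antitone_of_decMass_le hW), hP]
    rcases le_total k K with hk | hk
    · simpa using h.sum_range_add_le_topSum (b := 0) hQ (by simpa using hc) hk
    · rw [h.sum_range_eq_topSum_of_le hk]
      exact hQ k
  -- `P` need not be decreasing at `K`. An optimal set is split there: its lower part is at most a
  -- prefix sum, and its `b` upper symbols carry at most `Q.topSum (K + b) - Q.topSum K`.
  · obtain ⟨B, rfl, hB⟩ := P.exists_sum_eq_topSum k
    rw [← hB, hP]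
    have hcard := Finset.card_filter_add_card_filter_not (s := B) (fun i => i < K)
    rw [← Finset.sum_filter_add_sum_filter_not B (fun i => i < K), ← hcard]
    set B₁ := B.filter fun i => i < K
    set B₂ := B.filter fun i => ¬ i < K
    have hB₁ : ∀ i ∈ B₁, i < K := fun i hi => (Finset.mem_filter.1 hi).2
    have hB₂ : ∀ i ∈ B₂, K ≤ i := fun i hi => not_lt.1 (Finset.mem_filter.1 hi).2
    have hm : B₁.card ≤ K := by
      simpa using Finset.card_le_card fun i hi => Finset.mem_range.2 (hB₁ i hi)
    refine le_trans (add_le_add (sum_le_sum_range_card (fun i j hij hj =>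
      h.antitone_of_lt hij hj) B₁ hB₁) ?_) (h.sum_range_add_le_topSum hQ (hb B₂.card) hm)
    rw [Marginal.topSum, Marginal.topSum, Finset.sum_range_add, add_sub_cancel_left]
    have hinj : Set.InjOn (fun i => i - K) B₂ := fun i hi j hj hij => by
      have := hB₂ i hi
      have := hB₂ j hj
      simp only at hij
      omega
    have h1 : ∑ i ∈ B₂, f i = ∑ i ∈ B₂.image (fun i => i - K), Q.decMass (K + i) := by
      rw [Finset.sum_image hinj]
      refine Finset.sum_congr rfl fun i hi => ?_
      rw [h.eq_tail i (hB₂ i hi), Nat.add_sub_cancel' (hB₂ i hi)]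
    rw [h1, ← Finset.card_image_of_injOn hinj]
    exact sum_le_sum_range_card (n := (B₂.image fun i => i - K).sup id + 1)
      (fun i j hij _ => Q.decMass_antitone (by omega)) _
      fun i hi => Nat.lt_succ_of_le (Finset.le_sup (f := id) hi)

end IsFano

/-! ### Fano distributions as minimal elements for majorization -/

section Fano

variable {Q : Marginal} {L : ℕ} {ε : ℝ}

theorem isFanoHead_fanoMass (hL : 1 ≤ L) (hε : ε ≤ Q.listError L) {K : ℕ∞} (hK : (L : ℕ∞) ≤ K) :
    IsFanoHead Q (fanoJ Q L ε - 1) L (fanoV Q L ε (fanoJ Q L ε)) (1 - ε) (fanoMass Q L ε K) := by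
  obtain ⟨h1, h2, h3⟩ := fanoJ_spec Q L ε hL
  refine ⟨by omega, fun i hi => ?_, fun i hi hiL => ?_, sum_fanoMass_low Q L ε hL hε K hK,
    fun _ => h3.le, fun hJL i hi => ?_⟩
  · rw [fanoMass, if_pos (Or.inl (by omega))]
  · have hK' : ((i + 1 : ℕ) : ℕ∞) ≤ K := (Nat.cast_le.2 (by omega)).trans hK
    rw [fanoMass, if_neg (by rw [not_or]; exact ⟨by omega, not_lt.2 hK'⟩), if_pos (by omega)]
  -- By minimality the index `J - 1` fails the test, so `V(J - 1) ≤ Q↓(J - 1)`. Removing from an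
  -- average a term that is at least the average leaves a new average `V(J)` that is still at most
  -- that term.
  · obtain ⟨j, hj⟩ : ∃ j, fanoJ Q L ε = j + 2 := ⟨fanoJ Q L ε - 2, by omega⟩
    have hnot : ¬ (Q.decMass j < fanoV Q L ε (j + 1)) := fun hc => by
      have : fanoJ Q L ε ≤ j + 1 := Nat.sInf_le ⟨by omega, by simpa using hc⟩
      omega
    refine le_trans ?_ (Q.decMass_antitone (by omega : i ≤ j))
    rw [hj] at hJL ⊢
    have hjL : (j : ℝ) + 2 ≤ L := by exact_mod_cast (by omega : j + 2 ≤ L)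
    rw [not_lt, fanoV, if_pos (by omega), Nat.add_sub_cancel,
      div_le_iff₀ (by push_cast; linarith)] at hnot
    rw [fanoV, if_pos (by omega), div_le_iff₀ (by push_cast; linarith),
      show j + 2 - 1 = j + 1 from rfl, Q.topSum_succ]
    push_cast at hnot ⊢
    linarith

theorem isFano_fanoMass (hL : 1 ≤ L) (hε : ε ≤ Q.listError L) {n : ℕ} (hn : L ≤ n)
    (hS : 1 - ε ≤ Q.topSum n) (hW : fanoW Q L ε n < Q.decMass (n - 1)) :
    IsFano Q (fanoJ Q L ε - 1) L n (fanoV Q L ε (fanoJ Q L ε)) (fanoW Q L ε n) (1 - ε)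
      (fanoMass Q L ε n) := by
  have h2 := (fanoJ_spec Q L ε hL).2.1
  have htail : ∀ i, n ≤ i → fanoMass Q L ε n i = Q.decMass i := fun i hi => by
    have : (n : ℕ∞) < ((i + 1 : ℕ) : ℕ∞) := Nat.cast_lt.2 (by omega)
    rw [fanoMass, if_pos (Or.inr this)]
  have hF := fanoMass_nat Q L ε hL hε n hn hS
  refine ⟨isFanoHead_fanoMass hL hε (Nat.cast_le.2 hn), hn, fun i hi hin => ?_,
    fun i _ hin => hW.le.trans (Q.decMass_antitone (by omega)), htail,
    Marginal.sum_range_eq_of_eq_tail (P := ⟨_, hF.1, hF.2⟩) (Q := Q.dec) htail⟩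
  have hK' : ((i + 1 : ℕ) : ℕ∞) ≤ n := Nat.cast_le.2 (by omega)
  rw [fanoMass, if_neg (by rw [not_or]; exact ⟨by omega, not_lt.2 hK'⟩), if_neg (by omega)]

/-- `W(n + 1)` is a weighted average of `W(n)` and `Q↓(n + 1)`; if it is at least the latter, so is
`W(n)`. -/
theorem decMass_le_fanoW {n : ℕ} (hn : L < n)
    (h : ¬ fanoW Q L ε ((n + 1 : ℕ) : ℕ∞) < Q.decMass n) : Q.decMass n ≤ fanoW Q L ε n := by
  have hn' : (L : ℝ) < n := by exact_mod_cast hn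
  rw [not_lt, fanoW_nat Q L ε (by omega), le_div_iff₀ (by push_cast; linarith),
    Q.topSum_succ] at h
  rw [fanoW_nat Q L ε hn, le_div_iff₀ (by linarith)]
  push_cast at h
  linarith

theorem fanoK₂_mem (hL : 1 ≤ L) (hε : ε ≤ Q.listError L) {N : ℕ}
    (hN : 1 - Q.topSum (N * L) ≤ ε) :
    fanoK₂ Q L ε N ≤ N * L ∧ fanoW Q L ε (fanoK₂ Q L ε N) < Q.decMass (fanoK₂ Q L ε N - 1) ∧
      (fanoK₂ Q L ε N < N * L →
        ¬ fanoW Q L ε ((fanoK₂ Q L ε N + 1 : ℕ) : ℕ∞) < Q.decMass (fanoK₂ Q L ε N)) := by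
  set A := {k : ℕ | L ≤ k ∧ k ≤ N * L ∧ fanoW Q L ε k < Q.decMass (k - 1)} with hA
  have hbdd : BddAbove A := ⟨N * L, fun k hk => hk.2.1⟩
  have hLK := (fanoK₂_spec Q L ε hL hε N hN).1
  have hne : A.Nonempty := by
    by_contra hc
    rw [Set.not_nonempty_iff_eq_empty] at hc
    -- An empty set would have supremum `0` in `ℕ`, contradicting `1 ≤ L ≤ K₂`.
    have : fanoK₂ Q L ε N = 0 := by
      rw [fanoK₂, ← hA, hc]
      simp
    omega
  have hmem : fanoK₂ Q L ε N ∈ A := Nat.sSup_mem hne hbdd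
  refine ⟨hmem.2.1, hmem.2.2, fun hlt hc => ?_⟩
  have : fanoK₂ Q L ε N + 1 ≤ fanoK₂ Q L ε N :=
    le_csSup hbdd ⟨by omega, hlt, by simpa using hc⟩
  omega

theorem isFano_fanoType2 (hL : 1 ≤ L) (hε : ε ≤ Q.listError L) {N : ℕ}
    (hN : 1 - Q.topSum (N * L) ≤ ε) :
    IsFano Q (fanoJ Q L ε - 1) L (fanoK₂ Q L ε N) (fanoV Q L ε (fanoJ Q L ε))
      (fanoW Q L ε (fanoK₂ Q L ε N)) (1 - ε) (fanoType2 Q L ε N hL hN hε).mass :=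
  isFano_fanoMass hL hε (fanoK₂_spec Q L ε hL hε N hN).1 (fanoK₂_spec Q L ε hL hε N hN).2
    (fanoK₂_mem hL hε hN).2.1

/-- If `K₂ < N L`, maximality of `K₂` rules out an upward jump and the masses decrease. If `K₂ = N
L`, a jump is possible and the bounds `hb` for all `b` compensate for it. -/
theorem topSum_fanoType2_le (hL : 1 ≤ L) (hε : ε ≤ Q.listError L) {N : ℕ}
    (hN : 1 - Q.topSum (N * L) ≤ ε) {R : Marginal} (hQ : ∀ k, Q.topSum k ≤ R.topSum k)
    (hb : ∀ b, 1 - ε + (Q.topSum (N * L + b) - Q.topSum (N * L)) ≤ R.topSum (L + b)) (k : ℕ) :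
    (fanoType2 Q L ε N hL hN hε).topSum k ≤ R.topSum k := by
  refine (isFano_fanoType2 hL hε hN).topSum_le rfl hQ (by simpa using hb 0) ?_ k
  obtain ⟨h1, -, h3⟩ := fanoK₂_mem hL hε hN
  rcases h1.eq_or_lt with h | h
  · rw [← h] at hb
    exact Or.inr hb
  · exact Or.inl fun hLK => decMass_le_fanoW hLK (h3 h)

theorem topSum_le_fanoType2 (hL : 1 ≤ L) (hε : ε ≤ Q.listError L) {N : ℕ}
    (hN : 1 - Q.topSum (N * L) ≤ ε) (k : ℕ) :
    Q.topSum k ≤ (fanoType2 Q L ε N hL hN hε).topSum k :=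
  ((isFano_fanoType2 hL hε hN).topSum_le_sum k).trans (Marginal.sum_range_le_topSum _ k)

theorem one_sub_le_topSum_fanoType2 (hL : 1 ≤ L) (hε : ε ≤ Q.listError L) {N : ℕ}
    (hN : 1 - Q.topSum (N * L) ≤ ε) :
    1 - ε ≤ (fanoType2 Q L ε N hL hN hε).topSum L :=
  (isFano_fanoType2 hL hε hN).sum_eq.symm.le.trans (Marginal.sum_range_le_topSum _ L)

theorem le_mul_of_range (hL : 1 ≤ L) (hε : ε ≤ Q.listError L) {N : ℕ}
    (hN : 1 - Q.topSum (N * L) ≤ ε) : L ≤ N * L :=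
  (fanoK₂_spec Q L ε hL hε N hN).1.trans (fanoK₂_mem hL hε hN).1

theorem topSum_add_sub_le {n b : ℕ} (hn : L ≤ n) :
    Q.topSum L + (Q.topSum (n + b) - Q.topSum n) ≤ Q.topSum (L + b) := by
  simp only [Marginal.topSum, Finset.sum_range_add, add_sub_cancel_left]
  gcongr with i
  exact Q.decMass_antitone (by omega)

/-- At the maximal error probability the Fano distribution is a rearrangement of `Q`. -/
theorem dec_fanoType2_of_eq (hL : 1 ≤ L) (hε : ε ≤ Q.listError L) {N : ℕ}
    (hN : 1 - Q.topSum (N * L) ≤ ε) (heq : ε = Q.listError L) :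
    (fanoType2 Q L ε N hL hN hε).dec = Q.dec := by
  -- At the maximal `ε`, `Q` itself is an admissible competitor `R`.
  have h : ∀ k, (fanoType2 Q L ε N hL hN hε).topSum k = Q.topSum k := fun k =>
    le_antisymm (topSum_fanoType2_le hL hε hN (fun _ => le_rfl) (fun b => by
      have := topSum_add_sub_le (Q := Q) (b := b) (le_mul_of_range hL hε hN)
      rw [heq, Marginal.listError]
      linarith) k) (topSum_le_fanoType2 hL hε hN k)
  ext i
  have h1 := h (i + 1)
  rw [Marginal.topSum_succ, Marginal.topSum_succ, h i] at h1
  exact add_left_cancel h1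

theorem le_fanoType1 {φ : Marginal → ℝ≥0∞} (hsymm : IsSymmetric φ) (hconc : IsConcave φ)
    (hlsc : IsLowerSemicont φ) (hL : 1 ≤ L) (hε0 : 0 ≤ ε) (hε : ε ≤ Q.listError L) {R : Marginal}
    (hQ : ∀ k, Q.topSum k ≤ R.topSum k) (hc : 1 - ε ≤ R.topSum L) :
    φ R ≤ φ (fanoType1 Q L ε hL hε0 hε) := by
  refine le_of_topSum_le hsymm hconc hlsc fun k => ?_
  have hLK := le_fanoK₁ Q L ε
  -- An infinite cut-off gives a plateau of height zero, so all mass sits on the first `L` symbols.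
  -- At a finite cut-off the index `K₁ + 1` fails the test, hence the masses decrease and no tail
  -- bounds are needed.
  rcases eq_or_ne (fanoK₁ Q L ε) ⊤ with h | h
  · have hhead := isFanoHead_fanoMass hL hε hLK
    have h0 : ∀ i, L ≤ i → fanoMass Q L ε (fanoK₁ Q L ε) i = 0 := fun i hi => by
      have := (fanoJ_spec Q L ε hL).2.1
      rw [h, fanoMass, if_neg (by rw [not_or]; exact ⟨by omega, not_top_lt⟩), if_neg (by omega)]
      simp [fanoW]
    have hanti : Antitone (fanoType1 Q L ε hL hε0 hε).mass := fun i j hij => by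
      rcases lt_or_ge j L with hj | hj
      · exact hhead.antitone hij hj
      · exact (h0 j hj).le.trans ((fanoType1 Q L ε hL hε0 hε).nonneg i)
    rw [Marginal.topSum_eq_of_antitone hanti]
    rcases le_total k L with hk | hk
    · have := hhead.sum_range_add_le (b := 0) (x := 0) (fun m _ => by simpa using hQ m)
        (by simpa using hc) hk
      rw [add_zero, add_zero] at this
      exact this
    · refine (sum_range_eq_of_const hk fun i hi _ => h0 i hi).le.trans ?_
      rw [mul_zero, add_zero, hhead.sum_eq]
      exact hc.trans (R.topSum_mono hk)
  · obtain ⟨n, hn⟩ := ENat.ne_top_iff_exists.1 h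
    rw [← hn, Nat.cast_le] at hLK
    have hbd : ∀ m : ℕ, L ≤ m → fanoW Q L ε m < Q.decMass (m - 1) → m ≤ n := fun m hm hc => by
      have : ((m : ℕ) : ℕ∞) ≤ fanoK₁ Q L ε := le_sSup ⟨m, rfl, hm, hc⟩
      rwa [← hn, Nat.cast_le] at this
    have hnext : ¬ fanoW Q L ε ((n + 1 : ℕ) : ℕ∞) < Q.decMass n := fun hc => by
      have := hbd (n + 1) (by omega) hc
      omega
    have hmem : fanoW Q L ε n < Q.decMass (n - 1) := by
      have hlt : ((n - 1 : ℕ) : ℕ∞) < fanoK₁ Q L ε := by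
        rw [← hn, Nat.cast_lt]
        omega
      obtain ⟨_, ⟨m, rfl, hm, hc⟩, hlt⟩ := lt_sSup_iff.1 hlt
      rw [Nat.cast_lt] at hlt
      have := hbd m hm hc
      rwa [show m = n by omega] at hc
    have hF := isFano_fanoMass hL hε hLK (le_topSum_of_not_lt Q L ε hLK hnext) hmem
    exact hF.topSum_le (P := fanoType1 Q L ε hL hε0 hε) (by rw [hn]; rfl) hQ hc
      (Or.inl fun hlt => decMass_le_fanoW hlt hnext) k

end Fano

/-! ### Pairs of random variables with finitely many values of the side information -/

/-- There are finitely many fibres, so the null ones can be discarded together. -/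
theorem ae_comp_iff {Ω 𝒴 : Type*} [MeasurableSpace Ω] [Fintype 𝒴] {μ : Measure Ω}
    [IsProbabilityMeasure μ] {Y : Ω → 𝒴} {p : 𝒴 → Prop} :
    (∀ᵐ ω ∂μ, p (Y ω)) ↔ ∀ y, μ.real (Y ⁻¹' {y}) ≠ 0 → p y := by
  constructor
  · intro h y hy
    by_contra hp
    refine hy ((measureReal_eq_zero_iff).2 (measure_mono_null (fun ω hω => ?_) (ae_iff.1 h)))
    rw [Set.mem_preimage, Set.mem_singleton_iff] at hω
    simpa [hω] using hp
  · intro h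
    have : ∀ᵐ ω ∂μ, ∀ y, Y ω = y → p y := by
      rw [ae_all_iff]
      intro y
      by_cases hy : μ.real (Y ⁻¹' {y}) = 0
      · rw [measureReal_eq_zero_iff] at hy
        filter_upwards [measure_eq_zero_iff_ae_notMem.1 hy] with ω hω hc
        exact absurd hc hω
      · exact ae_of_all _ fun _ _ => h y hy
    filter_upwards [this] with ω hω
    exact hω _ rfl

section Pairs

variable {Ω 𝒴 : Type*} [MeasurableSpace Ω] [MeasurableSpace 𝒴]
  [MeasurableSingletonClass 𝒴] {μ : Measure Ω} [IsProbabilityMeasure μ] {X : Ω → ℕ} {Y : Ω → 𝒴}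

/-- The product form avoids dividing by the probability of a fibre: on null fibres both sides
vanish, whatever the conditional law is there. -/
theorem weight_mul_condMarginal (hX : Measurable X) (hY : Measurable Y) (y : 𝒴) (x : ℕ) :
    μ.real (Y ⁻¹' {y}) * (condMarginal μ X Y y).mass x = μ.real (X ⁻¹' {x} ∩ Y ⁻¹' {y}) := by
  have hm : MeasurableSet (Y ⁻¹' {y}) := hY (measurableSet_singleton y)
  by_cases h0 : μ (Y ⁻¹' {y}) = 0
  · have h1 : μ (X ⁻¹' {x} ∩ Y ⁻¹' {y}) = 0 := measure_mono_null Set.inter_subset_right h0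
    simp [measureReal_def, h0, h1]
  · have h2 : (μ.map Y) {y} ≠ 0 := by rwa [Measure.map_apply hY (measurableSet_singleton y)]
    have h3 : (condMarginal μ X Y y).mass x = (condDistrib X Y μ y).real {x} := rfl
    rw [h3, measureReal_def, measureReal_def, measureReal_def,
      condDistrib_apply_of_ne_zero hX y h2, Measure.map_apply hY (measurableSet_singleton y),
      Measure.map_apply (hY.prodMk hX)
        ((measurableSet_singleton y).prod (measurableSet_singleton x)),
      ← ENNReal.toReal_mul, ← mul_assoc, ENNReal.mul_inv_cancel h0 (measure_ne_top μ _), one_mul]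
    congr 2
    ext ω
    simp [and_comm]

variable [Fintype 𝒴]

theorem measureReal_eq_sum_inter (hY : Measurable Y) {s : Set Ω} :
    μ.real s = ∑ y, μ.real (s ∩ Y ⁻¹' {y}) := by
  have hm : ∀ y, MeasurableSet (Y ⁻¹' {y}) := fun y => hY (measurableSet_singleton y)
  have := sum_measureReal_preimage_singleton (μ := μ.restrict s) (f := Y) Finset.univ
    fun y _ => hm y
  simp only [measureReal_restrict_apply (hm _), Finset.coe_univ, Set.preimage_univ,
    measureReal_restrict_apply MeasurableSet.univ, Set.univ_inter] at this
  rw [← this]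
  simp only [Set.inter_comm]

theorem sum_weight (hY : Measurable Y) : ∑ y, μ.real (Y ⁻¹' {y}) = 1 := by
  have := measureReal_eq_sum_inter (μ := μ) hY (s := Set.univ)
  simpa using this.symm

theorem HasMarginal.mass_eq_sum {Q : Marginal} (h : HasMarginal Q μ X Y) (x : ℕ) :
    Q.mass x = ∑ y, μ.real (Y ⁻¹' {y}) * (condMarginal μ X Y y).mass x := by
  rw [← h.law, measureReal_eq_sum_inter h.measurable_snd]
  exact Finset.sum_congr rfl fun y _ =>
    (weight_mul_condMarginal h.measurable_fst h.measurable_snd y x).symm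

theorem condInfo_eq_sum (φ : Marginal → ℝ≥0∞) (hY : Measurable Y) :
    condInfo φ μ X Y = ∑ y, ENNReal.ofReal (μ.real (Y ⁻¹' {y})) * φ (condMarginal μ X Y y) := by
  rw [condInfo, ← lintegral_map (f := fun y => φ (condMarginal μ X Y y)) .of_discrete hY,
    lintegral_fintype]
  refine Finset.sum_congr rfl fun y _ => ?_
  rw [Measure.map_apply hY (measurableSet_singleton y), ofReal_measureReal, mul_comm]

theorem measureReal_notMem (hX : Measurable X) (hY : Measurable Y) (f : 𝒴 → Finset ℕ) :
    μ.real {ω | X ω ∉ f (Y ω)}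
      = 1 - ∑ y, μ.real (Y ⁻¹' {y}) * ∑ x ∈ f y, (condMarginal μ X Y y).mass x := by
  have hms : MeasurableSet {ω | X ω ∈ f (Y ω)} := by
    have : {ω | X ω ∈ f (Y ω)} = ⋃ y, X ⁻¹' (f y) ∩ Y ⁻¹' {y} := by
      ext ω
      simp
    rw [this]
    exact .iUnion fun y => (hX .of_discrete).inter (hY (measurableSet_singleton y))
  have hc := probReal_compl_eq_one_sub (μ := μ) hms
  refine hc.trans ?_
  rw [measureReal_eq_sum_inter hY (s := {ω | X ω ∈ f (Y ω)})]
  congr 1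
  refine Finset.sum_congr rfl fun y _ => ?_
  have hset : {ω | X ω ∈ f (Y ω)} ∩ Y ⁻¹' {y} = X ⁻¹' (f y) ∩ Y ⁻¹' {y} := by
    ext ω
    simp only [Set.mem_inter_iff, Set.mem_ofPred_eq, Set.mem_preimage, Set.mem_singleton_iff,
      Finset.mem_coe]
    exact and_congr_left fun h => by rw [h]
  have hm : ∀ x, MeasurableSet (X ⁻¹' {x}) := fun x => hX .of_discrete
  have := sum_measureReal_preimage_singleton (μ := μ.restrict (Y ⁻¹' {y})) (f := X) (f y)
    fun x _ => hm x
  simp only [measureReal_restrict_apply (hm _)] at this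
  rw [measureReal_restrict_apply (hX .of_discrete)] at this
  rw [hset, ← this, Finset.mul_sum]
  exact Finset.sum_congr rfl fun x _ => (weight_mul_condMarginal hX hY y x).symm

/-- The optimization decouples over the fibres; listing the `L` heaviest symbols for each `y`
attains the infimum. -/
theorem condListError_eq {L : ℕ} (hL : 1 ≤ L) (hX : Measurable X) (hY : Measurable Y) :
    condListError L μ X Y
      = 1 - ∑ y, μ.real (Y ⁻¹' {y}) * (condMarginal μ X Y y).topSum L := by
  choose B hB hBsum using fun y => (condMarginal μ X Y y).exists_sum_eq_topSum L
  have hbdd : BddBelow (Set.range fun f : 𝒴 → {D : Finset ℕ // 1 ≤ D.card ∧ D.card ≤ L} =>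
      μ.real {ω | X ω ∉ (f (Y ω)).1}) := ⟨0, by rintro _ ⟨f, rfl⟩; exact measureReal_nonneg⟩
  have : Nonempty (𝒴 → {D : Finset ℕ // 1 ≤ D.card ∧ D.card ≤ L}) :=
    ⟨fun _ => ⟨{0}, by simp, by simpa using hL⟩⟩
  refine le_antisymm ?_ (le_ciInf fun f => ?_)
  · refine (ciInf_le hbdd fun y => ⟨B y, by rw [hB]; exact hL, (hB y).le⟩).trans ?_
    rw [measureReal_notMem hX hY B]
    simp only [hBsum, le_refl]
  · rw [measureReal_notMem hX hY fun y => (f y).1]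
    gcongr with y
    exact ((condMarginal μ X Y y).sum_le_topSum _).trans
      (Marginal.topSum_mono _ (f y).2.2)

end Pairs

/-- Every finite decomposition of `Q` is realized by a pair of random variables. -/
theorem exists_hasMarginal {𝒴 : Type v} [Fintype 𝒴] [MeasurableSpace 𝒴]
    [MeasurableSingletonClass 𝒴] {w : 𝒴 → ℝ} {P : 𝒴 → Marginal} {Q : Marginal}
    (hw : ∀ y, 0 ≤ w y) (hsum : ∑ y, w y = 1)
    (hQ : ∀ x, Q.mass x = ∑ y, w y * (P y).mass x) :
    ∃ (Ω : Type u) (_ : MeasurableSpace Ω) (μ : Measure Ω) (_ : IsProbabilityMeasure μ)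
      (X : Ω → ℕ) (Y : Ω → 𝒴), HasMarginal Q μ X Y ∧
      ∀ y, μ.real (Y ⁻¹' {y}) ≠ 0 → condMarginal μ X Y y = P y := by
  -- Indexing by `Fin` lets the sample space live in universe `u`, independently of the universe of
  -- `𝒴`.
  let e := Fintype.equivFin 𝒴
  let Ω := ULift.{u} (ℕ × Fin (Fintype.card 𝒴))
  let X : Ω → ℕ := fun ω => ω.down.1
  let Y : Ω → 𝒴 := fun ω => e.symm ω.down.2
  let g : Ω → ℝ≥0∞ := fun ω => ENNReal.ofReal (w (Y ω) * (P (Y ω)).mass (X ω))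
  have hg : HasSum g 1 := by
    have h1 : ∑' ω, g ω = 1 := by
      rw [← Equiv.ulift.symm.tsum_eq, ENNReal.tsum_prod', ENNReal.tsum_comm, tsum_fintype]
      have h2 : ∀ i : Fin (Fintype.card 𝒴), ∑' x : ℕ, g (Equiv.ulift.symm (x, i))
          = ENNReal.ofReal (w (e.symm i)) := fun i => by
        change ∑' x : ℕ, ENNReal.ofReal (w (e.symm i) * (P (e.symm i)).mass x) = _
        have h3 := (P (e.symm i)).hasSum.mul_left (w (e.symm i))
        rw [← ENNReal.ofReal_tsum_of_nonneg
          (fun x => mul_nonneg (hw _) ((P (e.symm i)).nonneg x)) h3.summable, h3.tsum_eq, mul_one]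
      simp only [h2]
      rw [e.symm.sum_comp fun y => ENNReal.ofReal (w y),
        ← ENNReal.ofReal_sum_of_nonneg fun y _ => hw y, hsum, ENNReal.ofReal_one]
    rw [← h1]
    exact ENNReal.summable.hasSum
  let _ : MeasurableSpace Ω := ⊤
  let p : PMF Ω := ⟨g, hg⟩
  have hX : Measurable X := fun _ _ => trivial
  have hY : Measurable Y := fun _ _ => trivial
  have hjoint : ∀ x y, p.toMeasure.real (X ⁻¹' {x} ∩ Y ⁻¹' {y}) = w y * (P y).mass x := by
    intro x y
    have hset : X ⁻¹' {x} ∩ Y ⁻¹' {y} = {ULift.up (x, e y)} := by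
      ext ⟨x', i⟩
      simp only [X, Y, Set.mem_inter_iff, Set.mem_preimage, Set.mem_singleton_iff,
        Equiv.symm_apply_eq]
      exact ⟨fun h => by rw [← h.1, ← h.2], fun h => Prod.ext_iff.1 (congrArg ULift.down h)⟩
    have hm : MeasurableSet ({ULift.up (x, e y)} : Set Ω) := trivial
    rw [hset, measureReal_def, PMF.toMeasure_apply_singleton _ _ hm]
    change (ENNReal.ofReal (w (e.symm (e y)) * (P (e.symm (e y))).mass x)).toReal = _
    rw [Equiv.symm_apply_apply, ENNReal.toReal_ofReal (mul_nonneg (hw y) ((P y).nonneg x))]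
  refine ⟨Ω, ⊤, p.toMeasure, inferInstance, X, Y, ⟨hX, hY, fun x => ?_⟩, fun y hy => ?_⟩
  · rw [measureReal_eq_sum_inter hY, hQ]
    exact Finset.sum_congr rfl fun y _ => hjoint x y
  · have hmul : ∀ x, p.toMeasure.real (Y ⁻¹' {y}) * (condMarginal p.toMeasure X Y y).mass x
        = w y * (P y).mass x := fun x => by rw [weight_mul_condMarginal hX hY, hjoint]
    have h1 := (condMarginal p.toMeasure X Y y).hasSum.mul_left (p.toMeasure.real (Y ⁻¹' {y}))
    have h2 := (P y).hasSum.mul_left (w y)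
    simp only [hmul, mul_one] at h1
    have h3 := h1.unique (by simpa using h2)
    ext x
    have h4 := hmul x
    rw [← h3] at h4
    exact mul_left_cancel₀ hy h4

/-! ### The upper bound -/

/-- Only a finite block is sorted: no bijection of `ℕ` need sort a whole distribution, since
infinitely many positive masses leave no place for a zero. -/
theorem exists_perm_antitone (g : ℕ → ℝ) (n : ℕ) :
    ∃ σ : Equiv.Perm ℕ, (∀ i, n ≤ i → σ i = i) ∧ ∀ i j, i ≤ j → j < n → g (σ j) ≤ g (σ i) := by
  let s := Tuple.sort fun i : Fin n => -g i
  have hs := Tuple.monotone_sort fun i : Fin n => -g i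
  have happ : ∀ i : Fin n, s.extendDomain Fin.equivSubtype (i : ℕ) = s i := fun i =>
    s.extendDomain_apply_image Fin.equivSubtype i
  refine ⟨s.extendDomain Fin.equivSubtype, fun i hi =>
    s.extendDomain_apply_not_subtype _ (not_lt.2 hi), fun i j hij hj => ?_⟩
  have h1 := happ ⟨i, by omega⟩
  have h2 := happ ⟨j, hj⟩
  simp only at h1 h2
  rw [h1, h2]
  exact neg_le_neg_iff.1 (hs (show (⟨i, by omega⟩ : Fin n) ≤ ⟨j, hj⟩ from hij))

/-- Permutations of `ℕ` act multiply transitively, so the initial segment can be moved onto `A`. -/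
theorem exists_perm_mem_iff (A : Finset ℕ) :
    ∃ τ : Equiv.Perm ℕ, ∀ i, τ i ∈ A ↔ i < A.card := by
  obtain ⟨τ, hτ⟩ := (Equiv.Perm.isMultiplyPretransitive ℕ A.card).exists_smul_eq
    Fin.valEmbedding (A.equivFin.symm.toEmbedding.trans (Function.Embedding.subtype _))
  have happ : ∀ i : Fin A.card, τ i = A.equivFin.symm i := fun i => DFunLike.congr_fun hτ i
  refine ⟨τ, fun i => ⟨fun hi => ?_, fun hi => ?_⟩⟩
  · have := happ (A.equivFin ⟨τ i, hi⟩)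
    rw [Equiv.symm_apply_apply] at this
    rw [← τ.injective this]
    exact Fin.is_lt _
  · rw [happ ⟨i, hi⟩]
    exact Subtype.property _

/-- The components of a finite mixture can be rearranged in such a way that the new mixture
majorizes the old one and assigns large probability to some set of `L` symbols. -/
theorem exists_rearranged_mixture {ι : Type*} [Fintype ι] {w : ι → ℝ} {P : ι → Marginal}
    {Q : Marginal} (hw : ∀ y, 0 ≤ w y) (hsum : ∑ y, w y = 1)
    (hQ : ∀ x, Q.mass x = ∑ y, w y * (P y).mass x) {L : ℕ} (hL : L ≤ Fintype.card ι * L) :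
    ∃ (R : ι → Marginal) (M : Marginal), (∀ y, (R y).dec = (P y).dec) ∧
      (∀ x, M.mass x = ∑ y, w y * (R y).mass x) ∧ (∀ k, Q.topSum k ≤ M.topSum k) ∧
      ∀ b, ∑ y, w y * (P y).topSum L
        + (Q.topSum (Fintype.card ι * L + b) - Q.topSum (Fintype.card ι * L))
          ≤ M.topSum (L + b) := by
  classical
  choose B hB hBsum using fun y => (P y).exists_sum_eq_topSum L
  -- All optimal lists fit into one set, padded to exactly `|ι| L` symbols. It is relabelled as the
  -- initial block and each component is sorted there, so that all optimal lists become the same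
  -- first `L` places.
  obtain ⟨A, hBA, hA⟩ := Infinite.exists_superset_card_eq (Finset.univ.biUnion B)
    (Fintype.card ι * L) (Finset.card_biUnion_le_card_mul _ _ _ fun y _ => (hB y).le)
  obtain ⟨τ, hτ⟩ := exists_perm_mem_iff A
  rw [hA] at hτ
  set n := Fintype.card ι * L with hn
  choose σ hσfix hσanti using fun y => exists_perm_antitone (fun i => (P y).mass (τ i)) n
  let R : ι → Marginal := fun y => ((P y).perm τ).perm (σ y)
  let M := Marginal.mixture Finset.univ w R (fun y _ => hw y) hsum
  have hMmass : ∀ x, M.mass x = ∑ y, w y * (R y).mass x := fun _ => rfl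
  have hMsum : ∀ D : Finset ℕ, ∑ x ∈ D, M.mass x = ∑ y, w y * ∑ x ∈ D, (R y).mass x := fun D => by
    simp only [hMmass, Finset.mul_sum]
    exact Finset.sum_comm
  have hQsum : ∀ D : Finset ℕ, ∑ x ∈ D, Q.mass (τ x) = ∑ y, w y * ∑ x ∈ D, (P y).mass (τ x) :=
    fun D => by
      simp only [hQ, Finset.mul_sum]
      exact Finset.sum_comm
  have hR : ∀ y, ∀ D : Finset ℕ, (∀ i ∈ D, i < n) →
      ∑ x ∈ D, (P y).mass (τ x) ≤ ∑ x ∈ Finset.range D.card, (R y).mass x := by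
    intro y D hD
    have h1 : ∑ x ∈ D, (P y).mass (τ x)
        = ∑ x ∈ D.map (σ y).symm.toEmbedding, (R y).mass x := by
      rw [Finset.sum_map]
      refine Finset.sum_congr rfl fun x _ => ?_
      simp [R, Marginal.perm]
    rw [h1, ← Finset.card_map (σ y).symm.toEmbedding]
    refine sum_le_sum_range_card (hσanti y) _ fun i hi => ?_
    obtain ⟨x, hx, rfl⟩ := Finset.mem_map.1 hi
    by_contra hc
    have h2 := hσfix y _ (not_lt.1 hc)
    simp only [Equiv.coe_toEmbedding, Equiv.apply_symm_apply] at h2 hc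
    rw [← h2] at hc
    exact hc (hD x hx)
  have htail : ∀ x, n ≤ x → M.mass x = Q.mass (τ x) := fun x hx => by
    rw [hQ, hMmass]
    refine Finset.sum_congr rfl fun y _ => ?_
    simp [R, Marginal.perm, hσfix y x hx]
  have hpull : ∀ C : Finset ℕ, ∑ x ∈ C.map τ.symm.toEmbedding, Q.mass (τ x)
      = ∑ x ∈ C, Q.mass x := fun C => by
    rw [Finset.sum_map]
    simp
  refine ⟨R, M, fun y => by rw [Marginal.dec_perm, Marginal.dec_perm], hMmass, fun k => ?_,
    fun b => ?_⟩
  -- Inside the block, sorting aligns the components, so a prefix of `M` beats any set of the same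
  -- size; outside it `M` is the relabelled `Q`.
  · obtain ⟨C, hC, hCsum⟩ := Q.exists_sum_eq_topSum k
    set D := C.map τ.symm.toEmbedding with hD
    have hDcard : D.card = k := by rw [hD, Finset.card_map, hC]
    have hcard := Finset.card_filter_add_card_filter_not (s := D) (fun i => i < n)
    rw [← hCsum, ← hpull, ← hD, ← Finset.sum_filter_add_sum_filter_not D (fun i => i < n),
      ← hDcard, ← hcard]
    set D₁ := D.filter fun i => i < n
    set D₂ := D.filter fun i => ¬ i < n
    have hD₁ : ∀ i ∈ D₁, i < n := fun i hi => (Finset.mem_filter.1 hi).2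
    have hD₂ : ∀ i ∈ D₂, n ≤ i := fun i hi => not_lt.1 (Finset.mem_filter.1 hi).2
    have hD₁n : D₁.card ≤ n := by
      simpa using Finset.card_le_card fun i hi => Finset.mem_range.2 (hD₁ i hi)
    have hdisj : Disjoint (Finset.range D₁.card) D₂ := Finset.disjoint_left.2 fun i hi hi' => by
      have := hD₂ i hi'
      rw [Finset.mem_range] at hi
      omega
    have h3 := M.sum_le_topSum (Finset.range D₁.card ∪ D₂)
    rw [Finset.card_union_of_disjoint hdisj, Finset.card_range, Finset.sum_union hdisj] at h3
    refine le_trans (add_le_add ?_ (Finset.sum_congr rfl fun i hi =>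
      (htail i (hD₂ i hi)).symm).le) h3
    rw [hQsum, hMsum]
    exact Finset.sum_le_sum fun y _ => mul_le_mul_of_nonneg_left (hR y D₁ hD₁) (hw y)
  · obtain ⟨C, hC, hCsum⟩ := Q.exists_sum_eq_topSum (n + b)
    -- At least `b` of the `n + b` heaviest symbols lie outside `A`. Any `b` of these carry enough
    -- mass, since the other `n` carry at most `Q.topSum n`.
    have hCA : b ≤ (C \ A).card := by
      have := Finset.le_card_sdiff A C
      omega
    obtain ⟨C', hC'sub, hC'⟩ := Finset.exists_subset_card_eq hCA
    have hC'C : C' ⊆ C := hC'sub.trans Finset.sdiff_subset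
    have h1 : Q.topSum (n + b) - Q.topSum n ≤ ∑ x ∈ C', Q.mass x := by
      have h2 := Q.sum_le_topSum (C \ C')
      rw [Finset.card_sdiff_of_subset hC'C, hC, hC', Nat.add_sub_cancel] at h2
      rw [← hCsum, ← Finset.sum_sdiff hC'C]
      linarith
    set D := C'.map τ.symm.toEmbedding with hD
    have hDn : ∀ i ∈ D, n ≤ i := fun i hi => by
      obtain ⟨x, hx, rfl⟩ := Finset.mem_map.1 hi
      have h2 := hτ (τ.symm x)
      rw [Equiv.apply_symm_apply] at h2
      exact not_lt.1 fun hc => (Finset.mem_sdiff.1 (hC'sub hx)).2 (h2.2 hc)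
    have hdisj : Disjoint (Finset.range L) D := Finset.disjoint_left.2 fun i hi hi' => by
      have := hDn i hi'
      rw [Finset.mem_range] at hi
      omega
    have h3 := M.sum_le_topSum (Finset.range L ∪ D)
    rw [Finset.card_union_of_disjoint hdisj, Finset.card_range, Finset.sum_union hdisj,
      hD, Finset.card_map, hC', ← hD, Finset.sum_congr rfl fun i hi => htail i (hDn i hi), hD,
      hpull] at h3
    refine le_trans (add_le_add ?_ h1) h3
    rw [hMsum]
    refine Finset.sum_le_sum fun y _ => mul_le_mul_of_nonneg_left ?_ (hw y)
    have h4 := hR y ((B y).map τ.symm.toEmbedding) fun i hi => by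
      obtain ⟨x, hx, rfl⟩ := Finset.mem_map.1 hi
      refine (hτ _).1 ?_
      rw [Equiv.coe_toEmbedding, Equiv.apply_symm_apply]
      exact hBA (Finset.mem_biUnion.2 ⟨y, Finset.mem_univ y, hx⟩)
    rw [Finset.card_map, hB, Finset.sum_map] at h4
    rw [← hBsum]
    simpa using h4

/-! ### Attainment -/

/-- The decomposition of `Q` into rearrangements of a Fano distribution. -/
theorem IsFano.exists_mixture {Q P : Marginal} {a L K : ℕ} {V W c : ℝ}
    (h : IsFano Q a L K V W c P.mass) (haL : a < L) (hLK : L < K)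
    {ι : Type*} [Fintype ι]
    (hcard : min ((K - a).choose (L - a)) ((K - a - 1) ^ 2 + 1) ≤ Fintype.card ι) :
    ∃ (w : ι → ℝ) (R : ι → Marginal), (∀ y, 0 ≤ w y) ∧ ∑ y, w y = 1 ∧
      (∀ y, (R y).dec = P.dec) ∧ ∀ x, Q.mass x = ∑ y, w y * (R y).mass x := by
  classical
  have hmem := mem_convexHull_perm_of_sum_range_le (p := P.mass) (q := Q.decMass) (n := K)
    (fun i j hij _ => Q.decMass_antitone hij) h.eq_tail (fun k _ => h.topSum_le_sum k) h.sum_K_eq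
  have hagree : ∀ i, i < a ∨ K ≤ i → P.mass i = Q.decMass i := fun i hi =>
    hi.elim (h.eq_decMass i) (h.eq_tail i)
  -- The permutations fix everything outside the window from `a` to `K`. Restricting to it makes the
  -- space finite-dimensional, so Carathéodory's theorem yields affinely independent components.
  let ρ : (ℕ → ℝ) →ₗ[ℝ] (Fin (K - a) → ℝ) := LinearMap.funLeft ℝ ℝ fun i => a + i
  have hmem' := Set.mem_image_of_mem ρ hmem
  rw [LinearMap.image_convexHull] at hmem'
  obtain ⟨κ, _, z, w, hz, hind, hw, hsum, hzQ⟩ := eq_pos_convex_span_of_mem_convexHull hmem'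
  choose r hr hrz using fun k => hz ⟨k, rfl⟩
  choose σ hσ hrσ using hr
  have hκ₁ : Fintype.card κ ≤ K - a + 1 := by
    refine hind.card_le_finrank_succ.trans (Nat.succ_le_succ ?_)
    simpa using Submodule.finrank_le (vectorSpan ℝ (Set.range z))
  -- On the window a permuted Fano distribution takes only the values `V` and `W`, so it is
  -- determined by the `L - a` places holding `V`.
  have hκ₂ : Fintype.card κ ≤ (K - a).choose (L - a) := by
    let S : κ → Finset (Fin (K - a)) := fun k => Finset.univ.filter fun i => σ k (a + i) < L
    have hblock : ∀ k i, a ≤ i → i < K → a ≤ σ k i ∧ σ k i < K := by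
      intro k i h1 h2
      by_contra hc
      have h3 := hσ k (σ k i) (hagree _ (by omega))
      have h4 := (σ k).injective h3
      omega
    have hval : ∀ k (i : Fin (K - a)), z k i = if i ∈ S k then V else W := by
      intro k i
      have h1 : z k i = P.mass (σ k (a + i)) := by rw [← hrz, hrσ]; rfl
      have h2 := hblock k (a + i) (by omega) (by omega)
      simp only [S, Finset.mem_filter, Finset.mem_univ, true_and, h1]
      split_ifs with h3
      · exact h.eq_V _ h2.1 h3
      · exact h.eq_W _ (not_lt.1 h3) h2.2
    have hS : ∀ k, (S k).card = L - a := by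
      intro k
      refine Eq.trans ?_ (Nat.card_Ico a L)
      refine Finset.card_bij (fun i _ => σ k (a + i)) (fun i hi => ?_) (fun i _ j _ hij => ?_)
        fun m hm => ?_
      · simp only [S, Finset.mem_filter, Finset.mem_univ, true_and] at hi
        exact Finset.mem_Ico.2 ⟨(hblock k (a + i) (by omega) (by omega)).1, hi⟩
      · have := (σ k).injective hij
        ext
        omega
      · rw [Finset.mem_Ico] at hm
        have h1 : a ≤ (σ k).symm m ∧ (σ k).symm m < K := by
          by_contra hc
          have h3 := hσ k ((σ k).symm m) (hagree _ (by omega))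
          rw [Equiv.apply_symm_apply] at h3
          omega
        refine ⟨⟨(σ k).symm m - a, by omega⟩, ?_, ?_⟩
        · simp only [S, Finset.mem_filter, Finset.mem_univ, true_and,
            Nat.add_sub_cancel' h1.1, Equiv.apply_symm_apply]
          exact hm.2
        · simp only [Nat.add_sub_cancel' h1.1, Equiv.apply_symm_apply]
    have hSinj : Function.Injective S := fun k l hkl => hind.injective <| by
      funext i
      rw [hval, hval, hkl]
    calc Fintype.card κ = (Finset.univ.image S).card := by
          rw [Finset.card_image_of_injective _ hSinj, Finset.card_univ]
      _ ≤ (Finset.powersetCard (L - a) Finset.univ).card := by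
          refine Finset.card_le_card fun T hT => ?_
          obtain ⟨k, -, rfl⟩ := Finset.mem_image.1 hT
          exact Finset.mem_powersetCard.2 ⟨Finset.subset_univ _, hS k⟩
      _ = _ := by rw [Finset.card_powersetCard, Finset.card_univ, Fintype.card_fin]
  have hκ : Fintype.card κ ≤ Fintype.card ι := by
    refine le_trans (le_min hκ₂ ?_) hcard
    -- The dimension bound `d + 3` is at most `(d + 1)² + 1` once `d ≥ 1`. For `d = 0` it is not,
    -- but then the binomial bound equals `2`.
    obtain ⟨d, hd⟩ : ∃ d, K - a = d + 2 := ⟨K - a - 2, by omega⟩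
    rw [hd] at hκ₁ hκ₂ ⊢
    rcases Nat.eq_zero_or_pos d with rfl | hd0
    · rw [show L - a = 1 by omega] at hκ₂
      simpa using hκ₂
    · rw [show d + 2 - 1 = d + 1 from rfl]
      nlinarith
  obtain ⟨⟨e, he⟩⟩ : Nonempty (κ ↪ ι) := Function.Embedding.nonempty_of_card_le hκ
  -- The decomposition so far is of `Q↓`; pushing it along `τ` gives one of `Q`. Unused elements of
  -- `ι` receive weight zero.
  obtain ⟨τ, hτ, hQτ⟩ := Q.exists_injective_decMass
  have hdec : ∀ x, Q.decMass x = ∑ k, w k * P.mass (σ k x) := by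
    intro x
    by_cases hx : x < a ∨ K ≤ x
    · have : ∀ k, P.mass (σ k x) = Q.decMass x := fun k => by rw [hσ k x (hagree x hx), hagree x hx]
      simp only [this, ← Finset.sum_mul, hsum, one_mul]
    · have h1 := congrFun hzQ ⟨x - a, by omega⟩
      have h2 : ∀ f : ℕ → ℝ, ρ f ⟨x - a, by omega⟩ = f x := fun f => by
        change f (a + (x - a)) = f x
        rw [Nat.add_sub_cancel' (by omega)]
      rw [h2, Finset.sum_apply] at h1
      rw [← h1]
      refine Finset.sum_congr rfl fun k _ => ?_
      rw [Pi.smul_apply, smul_eq_mul, ← hrz, h2, hrσ]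
      rfl
  let R : κ → Marginal := fun k => (P.perm (σ k)).push τ hτ
  have hRdec : ∀ k, (R k).dec = P.dec := fun k => by rw [Marginal.dec_push, Marginal.dec_perm]
  have hsumι : ∀ f : κ → ℝ, ∑ y, Function.extend e f 0 y = ∑ k, f k := fun f => by
    rw [← Finset.sum_subset (Finset.subset_univ (Finset.univ.image e)) fun y _ hy => ?_,
      Finset.sum_image fun _ _ _ _ e' => he e']
    · simp only [he.extend_apply]
    · exact Function.extend_apply' _ _ _ fun ⟨k, hk⟩ =>
        hy (Finset.mem_image.2 ⟨k, Finset.mem_univ k, hk⟩)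
  refine ⟨Function.extend e w 0, Function.extend e R fun _ => P, fun y => ?_, by rw [hsumι, hsum],
    fun y => ?_, fun x => ?_⟩
  · by_cases hy : ∃ k, e k = y
    · obtain ⟨k, rfl⟩ := hy
      rw [he.extend_apply]
      exact (hw k).le
    · rw [Function.extend_apply' _ _ _ hy, Pi.zero_apply]
  · by_cases hy : ∃ k, e k = y
    · obtain ⟨k, rfl⟩ := hy
      rw [he.extend_apply, hRdec]
    · rw [Function.extend_apply' _ _ _ hy]
  · have hfun : ∀ y, Function.extend e w 0 y * (Function.extend e R (fun _ => P) y).mass x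
        = Function.extend e (fun k => w k * (R k).mass x) 0 y := fun y => by
      by_cases hy : ∃ k, e k = y
      · obtain ⟨k, rfl⟩ := hy
        simp only [he.extend_apply]
      · rw [Function.extend_apply' _ _ _ hy, Pi.zero_apply, zero_mul,
          Function.extend_apply' _ _ _ hy, Pi.zero_apply]
    simp only [hfun]
    rw [hsumι]
    by_cases hx : x ∈ Set.range τ
    · obtain ⟨i, rfl⟩ := hx
      rw [← hQτ, hdec]
      refine Finset.sum_congr rfl fun k _ => ?_
      rw [Marginal.push_apply]
      rfl
    · rw [Marginal.mass_eq_zero_of_notMem_range (P := Q.dec) hτ (fun i => (hQτ i).symm) hx]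
      refine (Finset.sum_eq_zero fun k _ => ?_).symm
      rw [Marginal.mass_eq_zero_of_notMem_range (P := P.perm (σ k)) hτ
        (Marginal.push_apply _ hτ) hx, mul_zero]

/-! ### The main theorem -/

section Main

variable {φ : Marginal → ℝ≥0∞} {Ω 𝒴 : Type*} [MeasurableSpace Ω] [Fintype 𝒴] [MeasurableSpace 𝒴]
  [MeasurableSingletonClass 𝒴] {Q : Marginal} {L : ℕ} {ε : ℝ} {μ : Measure Ω}
  [IsProbabilityMeasure μ] {X : Ω → ℕ} {Y : Ω → 𝒴}

/-- Common core of the upper bound and of its equality case: the rearranged mixture has the same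
average of `φ`, and its top sums dominate those of `P₂`. -/
theorem exists_mixture_majorizing_fanoType2 (hsymm : IsSymmetric φ) (hL : 1 ≤ L)
    (hε₁ : 1 - Q.topSum (Fintype.card 𝒴 * L) ≤ ε) (hε₂ : ε ≤ Q.listError L)
    (h : HasMarginal Q μ X Y) (herr : condListError L μ X Y ≤ ε) :
    ∃ (R : 𝒴 → Marginal) (M : Marginal), (∀ y, (R y).dec = (condMarginal μ X Y y).dec) ∧
      (∀ x, M.mass x = ∑ y, μ.real (Y ⁻¹' {y}) * (R y).mass x) ∧
      condInfo φ μ X Y = ∑ y, ENNReal.ofReal (μ.real (Y ⁻¹' {y})) * φ (R y) ∧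
      ∀ k, (fanoType2 Q L ε (Fintype.card 𝒴) hL hε₁ hε₂).topSum k ≤ M.topSum k := by
  obtain ⟨R, M, hR, hM, hQM, hb⟩ := exists_rearranged_mixture (fun _ => measureReal_nonneg)
    (sum_weight (μ := μ) h.measurable_snd) h.mass_eq_sum (le_mul_of_range hL hε₂ hε₁)
  refine ⟨R, M, hR, hM, ?_, topSum_fanoType2_le hL hε₂ hε₁ hQM fun b => ?_⟩
  · rw [condInfo_eq_sum φ h.measurable_snd]
    exact Finset.sum_congr rfl fun y _ => by rw [hsymm.eq_of_dec_eq (hR y)]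
  · rw [condListError_eq hL h.measurable_fst h.measurable_snd] at herr
    linarith [hb b]

theorem condInfo_le_fanoType2 (hsymm : IsSymmetric φ) (hconc : IsConcave φ)
    (hlsc : IsLowerSemicont φ) (hL : 1 ≤ L)
    (hε₁ : 1 - Q.topSum (Fintype.card 𝒴 * L) ≤ ε) (hε₂ : ε ≤ Q.listError L)
    (h : HasMarginal Q μ X Y) (herr : condListError L μ X Y ≤ ε) :
    condInfo φ μ X Y ≤ φ (fanoType2 Q L ε (Fintype.card 𝒴) hL hε₁ hε₂) := by
  obtain ⟨R, M, -, hM, hinfo, hmaj⟩ :=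
    exists_mixture_majorizing_fanoType2 hsymm hL hε₁ hε₂ h herr
  rw [hinfo]
  exact (hconc.sum_le (fun _ _ => measureReal_nonneg) (sum_weight h.measurable_snd) hM).trans
    (le_of_topSum_le hsymm hconc hlsc hmaj)

/-- Both inequalities of the upper bound become tight: equality in Jensen makes `R y = M` on fibres
of positive weight, and strict Schur concavity identifies `M↓` with `P₂↓`. -/
theorem dec_condMarginal_eq_of_condInfo_eq (hsymm : IsSymmetric φ) (hconc : IsConcave φ)
    (hlsc : IsLowerSemicont φ) (hstrict : IsStrictConcave φ) (hL : 1 ≤ L)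
    (hε₁ : 1 - Q.topSum (Fintype.card 𝒴 * L) ≤ ε) (hε₂ : ε ≤ Q.listError L)
    (hfin : φ (fanoType2 Q L ε (Fintype.card 𝒴) hL hε₁ hε₂) ≠ ∞)
    (h : HasMarginal Q μ X Y) (herr : condListError L μ X Y ≤ ε)
    (hinfo : condInfo φ μ X Y = φ (fanoType2 Q L ε (Fintype.card 𝒴) hL hε₁ hε₂)) {y : 𝒴}
    (hy : μ.real (Y ⁻¹' {y}) ≠ 0) :
    (condMarginal μ X Y y).dec = (fanoType2 Q L ε (Fintype.card 𝒴) hL hε₁ hε₂).dec := by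
  obtain ⟨R, M, hR, hM, hinfo', hmaj⟩ :=
    exists_mixture_majorizing_fanoType2 hsymm hL hε₁ hε₂ h herr
  have hw : ∀ y ∈ Finset.univ, 0 ≤ μ.real (Y ⁻¹' {y}) := fun _ _ => measureReal_nonneg
  have hsum := sum_weight (μ := μ) h.measurable_snd
  have h1 := hconc.sum_le hw hsum hM
  have h2 := le_of_topSum_le hsymm hconc hlsc hmaj
  rw [← hinfo', hinfo] at h1
  have hMeq := le_antisymm h2 h1
  rw [← hR y, hconc.eq_of_le_sum hstrict hw hsum hM (by rwa [hMeq])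
    (by rw [← hinfo', hinfo, hMeq]) (Finset.mem_univ y) hy]
  exact dec_eq_of_topSum_le hsymm hconc hlsc hstrict hmaj hfin hMeq

/-- Error and information see the conditional laws only through their rearrangements. -/
theorem condListError_le_and_condInfo_eq (hsymm : IsSymmetric φ) (hL : 1 ≤ L)
    (h : HasMarginal Q μ X Y) {P : Marginal} (hP : 1 - ε ≤ P.topSum L)
    (hdec : ∀ y, μ.real (Y ⁻¹' {y}) ≠ 0 → (condMarginal μ X Y y).dec = P.dec) :
    condListError L μ X Y ≤ ε ∧ condInfo φ μ X Y = φ P := by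
  have hsum := sum_weight (μ := μ) h.measurable_snd
  constructor
  · rw [condListError_eq hL h.measurable_fst h.measurable_snd]
    have : ∑ y, μ.real (Y ⁻¹' {y}) * (condMarginal μ X Y y).topSum L
        = ∑ y, μ.real (Y ⁻¹' {y}) * P.topSum L := by
      refine Finset.sum_congr rfl fun y _ => ?_
      by_cases hy : μ.real (Y ⁻¹' {y}) = 0
      · rw [hy, zero_mul, zero_mul]
      · rw [Marginal.topSum_congr (hdec y hy)]
    rw [this, ← Finset.sum_mul, hsum]
    linarith
  · rw [condInfo_eq_sum φ h.measurable_snd,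
      ← sum_ofReal_mul_const (fun _ _ => measureReal_nonneg) hsum (φ P)]
    refine Finset.sum_congr rfl fun y _ => ?_
    by_cases hy : μ.real (Y ⁻¹' {y}) = 0
    · rw [hy, ENNReal.ofReal_zero, zero_mul, zero_mul]
    · rw [hsymm.eq_of_dec_eq (hdec y hy)]

end Main

theorem exists_mixture_fanoType2 {𝒴 : Type v} [Fintype 𝒴] {Q : Marginal} {L : ℕ} {ε : ℝ}
    (hL : 1 ≤ L) (hε₁ : 1 - Q.topSum (Fintype.card 𝒴 * L) ≤ ε) (hε₂ : ε ≤ Q.listError L)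
    (hor : ε = Q.listError L ∨
      min ((fanoK₂ Q L ε (Fintype.card 𝒴) + 1 - fanoJ Q L ε).choose (L + 1 - fanoJ Q L ε) : ℤ)
        (((fanoK₂ Q L ε (Fintype.card 𝒴) : ℤ) - fanoJ Q L ε) ^ 2 + 1) ≤ Fintype.card 𝒴) :
    ∃ (w : 𝒴 → ℝ) (R : 𝒴 → Marginal), (∀ y, 0 ≤ w y) ∧ ∑ y, w y = 1 ∧
      (∀ y, (R y).dec = (fanoType2 Q L ε (Fintype.card 𝒴) hL hε₁ hε₂).dec) ∧
      ∀ x, Q.mass x = ∑ y, w y * (R y).mass x := by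
  by_cases heq : ε = Q.listError L
  · classical
    have hpos : 0 < Fintype.card 𝒴 := by
      by_contra hc
      have := le_mul_of_range hL hε₂ hε₁
      rw [Nat.eq_zero_of_not_pos hc] at this
      omega
    obtain ⟨y₀⟩ := Fintype.card_pos_iff.1 hpos
    exact ⟨fun y => if y = y₀ then 1 else 0, fun _ => Q, fun y => by positivity,
      by simp, fun _ => (dec_fanoType2_of_eq hL hε₂ hε₁ heq).symm, fun x => by simp⟩
  · have hF := isFano_fanoType2 hL hε₂ hε₁
    have hmin := hor.resolve_left heq
    obtain ⟨hJ1, hJ2, -⟩ := fanoJ_spec Q L ε hL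
    set K := fanoK₂ Q L ε (Fintype.card 𝒴)
    set J := fanoJ Q L ε
    -- If `J - 1 = L` or `K = L`, the first `L` Fano masses would sum to `Q.topSum L`; so below the
    -- maximal error the window has a nonempty part on each side of `L`.
    have hne : 1 - ε ≠ Q.topSum L := fun hc => heq (by rw [Marginal.listError]; linarith)
    have hJL : J - 1 < L := lt_of_le_of_ne hF.le_L fun hc =>
      hne (hF.sum_eq.symm.trans (hF.sum_range_eq_topSum hc.ge))
    have hLK : L < K := lt_of_le_of_ne hF.le_K fun hc =>
      hne (hF.sum_eq.symm.trans (hF.sum_range_eq_topSum_of_le hc.ge))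
    refine hF.exists_mixture hJL hLK ?_
    rw [show K - (J - 1) = K + 1 - J by omega, show L - (J - 1) = L + 1 - J by omega,
      show K + 1 - J - 1 = K - J by omega]
    have hcast : ((K - J : ℕ) : ℤ) = (K : ℤ) - J := by omega
    rw [← hcast] at hmin
    exact_mod_cast hmin

theorem theorem2 (φ : Marginal → ℝ≥0∞) (hsymm : IsSymmetric φ) (hconc : IsConcave φ)
    (hlsc : IsLowerSemicont φ)
    (𝒴 : Type v) [Fintype 𝒴] [MeasurableSpace 𝒴] [MeasurableSingletonClass 𝒴]
    (Q : Marginal) (L : ℕ) (hL : 1 ≤ L) (ε : ℝ)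
    (hε₁ : 1 - Q.topSum (Fintype.card 𝒴 * L) ≤ ε) (hε₂ : ε ≤ Q.listError L)
    (P₁ P₂ : Marginal) (J K₂ : ℕ)
    (hP₁ : P₁ = fanoType1 Q L ε hL (eps_nonneg_of_range Q L ε hε₁) hε₂)
    (hP₂ : P₂ = fanoType2 Q L ε (Fintype.card 𝒴) hL hε₁ hε₂)
    (hJ : J = fanoJ Q L ε) (hK₂ : K₂ = fanoK₂ Q L ε (Fintype.card 𝒴)) :
    -- the bound, and its comparison with the bound for arbitrary side information
    supCondInfo.{u, v} φ Q L ε 𝒴 ≤ φ P₂ ∧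
    φ P₂ ≤ φ P₁ ∧
    -- sufficient conditions for equality
    ((ε = Q.listError L ∨
        min ((K₂ + 1 - J).choose (L + 1 - J) : ℤ) (((K₂ : ℤ) - J) ^ 2 + 1) ≤ Fintype.card 𝒴) →
      supCondInfo.{u, v} φ Q L ε 𝒴 = φ P₂) ∧
    -- a sufficient condition on the pair `(X, Y)` for attaining the supremum
    (∀ (Ω : Type u) [MeasurableSpace Ω] (μ : Measure Ω) [IsProbabilityMeasure μ]
        (X : Ω → ℕ) (Y : Ω → 𝒴), HasMarginal Q μ X Y →
      (∀ x, ∀ᵐ ω ∂μ, (condMarginal μ X Y (Y ω)).dec.mass x = P₂.dec.mass x) →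
      condListError L μ X Y ≤ ε ∧
        condInfo φ μ X Y = supCondInfo.{u, v} φ Q L ε 𝒴 ∧
        supCondInfo.{u, v} φ Q L ε 𝒴 = φ P₂) ∧
    -- its necessity, when equality holds in the bound, for strictly concave `φ`
    (IsStrictConcave φ → φ P₂ ≠ ∞ → supCondInfo.{u, v} φ Q L ε 𝒴 = φ P₂ →
      ∀ (Ω : Type u) [MeasurableSpace Ω] (μ : Measure Ω) [IsProbabilityMeasure μ]
        (X : Ω → ℕ) (Y : Ω → 𝒴), HasMarginal Q μ X Y →
      ((condListError L μ X Y ≤ ε ∧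
          condInfo φ μ X Y = supCondInfo.{u, v} φ Q L ε 𝒴) ↔
        ∀ x, ∀ᵐ ω ∂μ, (condMarginal μ X Y (Y ω)).dec.mass x = P₂.dec.mass x)) := by

  subst hP₁ hP₂ hJ hK₂
  have hupper : supCondInfo.{u, v} φ Q L ε 𝒴
      ≤ φ (fanoType2 Q L ε (Fintype.card 𝒴) hL hε₁ hε₂) := by
    refine sSup_le ?_
    rintro _ ⟨Ω, _, μ, _, X, Y, h, herr, rfl⟩
    exact condInfo_le_fanoType2 hsymm hconc hlsc hL hε₁ hε₂ h herr
  have hdec : ∀ (Ω : Type u) [MeasurableSpace Ω] (μ : Measure Ω) [IsProbabilityMeasure μ]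
      (X : Ω → ℕ) (Y : Ω → 𝒴), (∀ x, ∀ᵐ ω ∂μ, (condMarginal μ X Y (Y ω)).dec.mass x
        = (fanoType2 Q L ε (Fintype.card 𝒴) hL hε₁ hε₂).dec.mass x) ↔
      ∀ y, μ.real (Y ⁻¹' {y}) ≠ 0 → (condMarginal μ X Y y).dec
        = (fanoType2 Q L ε (Fintype.card 𝒴) hL hε₁ hε₂).dec := by
    intro Ω _ μ _ X Y
    refine (forall_congr' fun x => ae_comp_iff
      (p := fun y => (condMarginal μ X Y y).dec.mass x = _)).trans ?_
    exact ⟨fun h y hy => Marginal.ext (funext fun x => h x y hy),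
      fun h x y hy => by rw [h y hy]⟩
  have hattain : ∀ (Ω : Type u) [MeasurableSpace Ω] (μ : Measure Ω) [IsProbabilityMeasure μ]
      (X : Ω → ℕ) (Y : Ω → 𝒴), HasMarginal Q μ X Y →
      (∀ y, μ.real (Y ⁻¹' {y}) ≠ 0 → (condMarginal μ X Y y).dec
        = (fanoType2 Q L ε (Fintype.card 𝒴) hL hε₁ hε₂).dec) →
      condListError L μ X Y ≤ ε ∧ condInfo φ μ X Y = supCondInfo.{u, v} φ Q L ε 𝒴 ∧
        supCondInfo.{u, v} φ Q L ε 𝒴 = φ (fanoType2 Q L ε (Fintype.card 𝒴) hL hε₁ hε₂) := by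
    intro Ω _ μ _ X Y h hy
    obtain ⟨herr, hinfo⟩ := condListError_le_and_condInfo_eq hsymm hL h
      (one_sub_le_topSum_fanoType2 hL hε₂ hε₁) hy
    have hsup := le_antisymm hupper
      (hinfo ▸ le_sSup ⟨Ω, _, μ, inferInstance, X, Y, h, herr, rfl⟩)
    exact ⟨herr, hinfo.trans hsup.symm, hsup⟩
  -- For the comparison with type 1, `P₂` itself serves as the competitor.
  refine ⟨hupper, le_fanoType1 hsymm hconc hlsc hL _ hε₂ (topSum_le_fanoType2 hL hε₂ hε₁)
    (one_sub_le_topSum_fanoType2 hL hε₂ hε₁), fun hor => ?_,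
    fun Ω _ μ _ X Y h hae => hattain Ω μ X Y h ((hdec Ω μ X Y).1 hae),
    fun hstrict hfin hsup Ω _ μ _ X Y h => ⟨fun ⟨herr, hinfo⟩ => ?_, fun hae => ?_⟩⟩
  · obtain ⟨w, R, hw, hsum, hR, hQ⟩ := exists_mixture_fanoType2 hL hε₁ hε₂ hor
    obtain ⟨Ω, _, μ, _, X, Y, h, hcond⟩ := exists_hasMarginal.{u, v} hw hsum hQ
    exact (hattain Ω μ X Y h fun y hy => by rw [hcond y hy, hR y]).2.2
  · exact (hdec Ω μ X Y).2 fun y hy => dec_condMarginal_eq_of_condInfo_eq hsymm hconc hlsc hstrict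
      hL hε₁ hε₂ hfin h herr (hinfo.trans hsup) hy
  · obtain ⟨herr, hinfo, -⟩ := hattain Ω μ X Y h ((hdec Ω μ X Y).1 hae)
    exact ⟨herr, hinfo⟩
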